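/- **Conventions.** Fix a universe of sets. A *distributor* $M : A ⇸ B$ between small categories is a functor $M : B^{op}\times A \to \mathbf{Set}$; the identity of $B$ is its hom functor, and $(N\circ M)(c,a)=\int^{b\in B} N(c,b)\times M(b,a)$. With natural transformations as 2-cells, small categories and distributors form a bicategory $\mathbf{Dist}$. The bicategory $\mathbf{PSH}$ has as objects the contravariant presheaves, i.e. the distributors $R : 1 ⇸ A$ with $1$ the terminal category; as 1-cells from $R : 1⇸A$ to $S : 1⇸B$ the pairs $(M,\alpha)$ of a distributor $M : A ⇸ B$ and a 2-cell $\alpha : M\circ R \Rightarrow S$; and as 2-cells $(M,\alpha)\Rightarrow(N,\beta)$ the 2-cells $\theta : M\Rightarrow N$ with $\beta\cdot(\theta R)=\alpha$. Both are regarded as categories by taking 1-cells up to invertible 2-cells, and $p:\mathbf{PSH}\to\mathbf{Dist}$ is the projection $R\mapsto A$, $(M,\alpha)\mapsto M$. **Theorem.** The refinement system $p : \mathbf{PSH}\to\mathbf{Dist}$ is symmetric monoidal closed. Precisely: 1. $\mathbf{Dist}$ is a symmetric monoidal closed category, with tensor product $A\times B$ on objects, $((c,d),(a,b))\mapsto M(c,a)\times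 N(d,b)$ on distributors, unit $1$, structure isomorphisms induced by the canonical equivalences between products of categories, implication $A\multimap B = A^{op}\times B$ and evaluation $A\otimes(A\multimap B)⇸B$, $(b',(a,(a',b)))\mapsto A(a',a)\times B(b',b)$. It is compact closed: $A^{op}$ is a dual of $A$. 2. $\mathbf{PSH}$ is a symmetric monoidal closed category, with tensor product and implication of $R:1⇸A$ and $S:1⇸B$ given by $$R\otimes S = \big((a,b)\mapsto Ra\times Sb\big) : 1 ⇸ A\times B,\qquad R\multimap S = \big((a,b)\mapsto (Ra\to Sb)\big) : 1⇸A^{op}\times B,$$ unit the terminal presheaf on $1$, tensor product of morphisms and structure isomorphisms given componentwise over those of $\mathbf{Dist}$, and evaluation $R\otimes(R\multimap S)\to S$ given over the evaluation of $\mathbf{Dist}$ by $((g,h),(r,\varphi))\mapsto S(h)(\varphi(R(g)r))$ for $g : a'\to a$ in $A$, $h : b'\to b$ in $B$, $r\in Ra$ and $\varphi : Ra'\to Sb$. 3. $p$ is a (strict) symmetric monoidal functor and preserves implication: the canonical comparison $p(R\multimap S)\to p(R)\multimap p(S)$ is an isomorphism. 4. The closed structures hold at the level of 2-cells: in $\mathbf{Dist}$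 the functor $M\mapsto \mathrm{ev}\circ(\mathrm{id}_A\otimes M)$ from the category of distributors $B⇸(A\multimap C)$ to that of distributors $A\otimes B⇸C$ is an equivalence of categories, and so is the functor $f\mapsto\mathrm{ev}\circ(\mathrm{id}_R\otimes f)$ from the category of 1-cells $S\to (R\multimap T)$ of $\mathbf{PSH}$ to that of 1-cells $R\otimes S\to T$. -/

import Mathlib

universe u

section

open CategoryTheory Opposite Bicategory

/-- An object of the bicategory of distributors: a small category. -/
structure DIST : Type (u + 1) where
  carrier : Type u
  [cat : SmallCategory carrier]

namespace DIST

instance : CoeSort DIST.{u} (Type u) := ⟨carrier⟩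

instance (A : DIST.{u}) : SmallCategory A := A.cat

section Composition
variable {A B C : Type u} [SmallCategory A] [SmallCategory B] [SmallCategory C]

/-- The integrand `(b, b') ↦ N(c, b') × M(b, a)` of the composition coend. -/
def integrand (M : Profunctor.{u} A B) (N : Profunctor.{u} B C) (a : A) (c : Cᵒᵖ) :
    Bᵒᵖ ⥤ B ⥤ Type u where
  obj b :=
    { obj b' := (N.obj b').obj c × (M.obj a).obj b
      map g := ↾fun x => ((N.map g).app c x.1, x.2) }
  map f := { app b' := ↾fun x => (x.1, (M.obj a).map f x.2) }

/-- The coend `∫^b N(c, b) × M(b, a)`. -/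
abbrev Coend (M : Profunctor.{u} A B) (N : Profunctor.{u} B C) (a : A) (c : Cᵒᵖ) : Type u :=
  Limits.Types.coend.{u, u, u} (integrand M N a c)

/-- The class of `(n, m)` in the coend. -/
def Coend.mk {M : Profunctor.{u} A B} {N : Profunctor.{u} B C} {a : A} {c : Cᵒᵖ}
    {b : B} (n : (N.obj b).obj c) (m : (M.obj a).obj (op b)) : Coend M N a c :=
  Quot.mk _ ⟨b, (n, m)⟩

theorem Coend.sound {M : Profunctor.{u} A B} {N : Profunctor.{u} B C} {a : A} {c : Cᵒᵖ}
    {b b' : B} (f : b ⟶ b') (n : (N.obj b).obj c) (m : (M.obj a).obj (op b')) :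
    (Coend.mk n ((M.obj a).map f.op m) : Coend M N a c) = Coend.mk ((N.map f).app c n) m :=
  Quot.sound (Limits.Types.coendRel.mk (F := integrand M N a c) f (n, m))

theorem Coend.ind {M : Profunctor.{u} A B} {N : Profunctor.{u} B C} {a : A} {c : Cᵒᵖ}
    {P : Coend M N a c → Prop}
    (h : ∀ (b : B) (n : (N.obj b).obj c) (m : (M.obj a).obj (op b)), P (Coend.mk n m)) (x) : P x := by
  obtain ⟨b, n, m⟩ := x
  exact h b n m

/-- The universal property of the coend. -/
def Coend.desc {M : Profunctor.{u} A B} {N : Profunctor.{u} B C} {a : A} {c : Cᵒᵖ} {X : Type u}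
    (φ : ∀ b : B, (N.obj b).obj c → (M.obj a).obj (op b) → X)
    (h : ∀ (b b' : B) (f : b ⟶ b') (n : (N.obj b).obj c) (m : (M.obj a).obj (op b')),
      φ b n ((M.obj a).map f.op m) = φ b' ((N.map f).app c n) m) : Coend M N a c → X :=
  Quot.lift (fun x => φ x.1 x.2.1 x.2.2) (by
    rintro _ _ ⟨f, n, m⟩
    exact h _ _ f n m)

@[simp] theorem Coend.desc_mk {M : Profunctor.{u} A B} {N : Profunctor.{u} B C} {a : A} {c : Cᵒᵖ}
    {X : Type u} (φ : ∀ b : B, (N.obj b).obj c → (M.obj a).obj (op b) → X) (h) {b : B}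
    (n : (N.obj b).obj c) (m : (M.obj a).obj (op b)) :
    Coend.desc φ h (Coend.mk n m) = φ b n m := rfl

/-- Composition of distributors, `(N ∘ M)(c, a) = ∫^b N(c, b) × M(b, a)`. -/
def comp (M : Profunctor.{u} A B) (N : Profunctor.{u} B C) : Profunctor.{u} A C where
  obj a :=
    { obj c := Coend M N a c
      map g := ↾Coend.desc (fun b n m => Coend.mk ((N.obj b).map g n) m) (by
        intro b b' f n m
        dsimp only
        rw [Coend.sound, NatTrans.naturality_apply])
      map_id c := by
        ext x
        induction x using Coend.ind
        simp
      map_comp g h := by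
        ext x
        induction x using Coend.ind
        simp }
  map f :=
    { app c := ↾Coend.desc (fun b n m => Coend.mk n ((M.map f).app (op b) m)) (by
        intro b b' g n m
        dsimp only
        rw [NatTrans.naturality_apply, Coend.sound])
      naturality c c' g := by
        ext x
        induction x using Coend.ind
        simp }
  map_id a := by
    ext c x
    induction x using Coend.ind
    simp
  map_comp f g := by
    ext c x
    induction x using Coend.ind
    simp


variable {D : Type u} [SmallCategory D]

theorem naturality_left {M M' : Profunctor.{u} A B} (θ : M ⟶ M') {a a' : A} (f : a ⟶ a') (b : Bᵒᵖ)
    (m : (M.obj a).obj b) :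
    (θ.app a').app b ((M.map f).app b m) = (M'.map f).app b ((θ.app a).app b m) :=
  ConcreteCategory.congr_hom (NatTrans.congr_app (θ.naturality f) b) m

theorem naturality_right {M M' : Profunctor.{u} A B} (θ : M ⟶ M') (a : A) {b b' : Bᵒᵖ} (g : b ⟶ b')
    (m : (M.obj a).obj b) :
    (θ.app a).app b' ((M.obj a).map g m) = (M'.obj a).map g ((θ.app a).app b m) :=
  ConcreteCategory.congr_hom ((θ.app a).naturality g) m

/-- Two 2-cells out of a composite agree if they agree on the representatives of the coend. -/
theorem hom_ext {M : Profunctor.{u} A B} {N : Profunctor.{u} B C} {P : Profunctor.{u} A C}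
    {α β : comp M N ⟶ P}
    (h : ∀ (a : A) (c : Cᵒᵖ) (b : B) (n : (N.obj b).obj c) (m : (M.obj a).obj (op b)),
      (α.app a).app c (Coend.mk n m) = (β.app a).app c (Coend.mk n m)) : α = β := by
  ext a c x
  induction x using Coend.ind
  apply h

/-- A 2-cell out of a composite, given on the representatives of the coend. -/
def homMk {M : Profunctor.{u} A B} {N : Profunctor.{u} B C} {P : Profunctor.{u} A C}
    (φ : ∀ (a : A) (c : Cᵒᵖ) (b : B), (N.obj b).obj c → (M.obj a).obj (op b) → (P.obj a).obj c)
    (h : ∀ (a : A) (c : Cᵒᵖ) (b b' : B) (f : b ⟶ b') (n : (N.obj b).obj c)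
      (m : (M.obj a).obj (op b')),
      φ a c b n ((M.obj a).map f.op m) = φ a c b' ((N.map f).app c n) m)
    (hr : ∀ (a : A) (c c' : Cᵒᵖ) (g : c ⟶ c') (b : B) (n : (N.obj b).obj c)
      (m : (M.obj a).obj (op b)),
      φ a c' b ((N.obj b).map g n) m = (P.obj a).map g (φ a c b n m))
    (hl : ∀ (a a' : A) (f : a ⟶ a') (c : Cᵒᵖ) (b : B) (n : (N.obj b).obj c)
      (m : (M.obj a).obj (op b)),
      φ a' c b n ((M.map f).app (op b) m) = (P.map f).app c (φ a c b n m)) :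
    comp M N ⟶ P where
  app a :=
    { app c := ↾Coend.desc (φ a c) (h a c)
      naturality c c' g := by
        ext x
        induction x using Coend.ind
        exact hr _ _ _ _ _ _ _ }
  naturality a a' f := by
    ext c x
    induction x using Coend.ind
    exact hl _ _ _ _ _ _ _

/-- Whiskering a 2-cell of distributors. -/
def whiskerL (M : Profunctor.{u} A B) {N N' : Profunctor.{u} B C} (θ : N ⟶ N') :
    comp M N ⟶ comp M N' :=
  homMk (fun a c b n m => Coend.mk ((θ.app b).app c n) m)
    (by
      intro a c b b' f n m
      dsimp only
      rw [Coend.sound, naturality_left])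
    (fun a c c' g b n m => congrArg (fun x => Coend.mk x m) (naturality_right θ b g n))
    (fun _ _ _ _ _ _ _ => rfl)

/-- Whiskering a 2-cell of distributors. -/
def whiskerR {M M' : Profunctor.{u} A B} (θ : M ⟶ M') (N : Profunctor.{u} B C) :
    comp M N ⟶ comp M' N :=
  homMk (fun a c b n m => Coend.mk n ((θ.app a).app (op b) m))
    (by
      intro a c b b' f n m
      dsimp only
      rw [naturality_right, Coend.sound])
    (fun _ _ _ _ _ _ _ => rfl)
    (fun a a' f c b n m => congrArg (fun x => Coend.mk n x) (naturality_left θ f (op b) m))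

/-- `P ∘ (N ∘ M) ≅ (P ∘ N) ∘ M`. -/
def assoc (M : Profunctor.{u} A B) (N : Profunctor.{u} B C) (P : Profunctor.{u} C D) :
    comp (comp M N) P ≅ comp M (comp N P) where
  hom := homMk (fun a d c p x =>
      Coend.desc (fun b n m => Coend.mk (N := comp N P) (Coend.mk p n) m)
      (fun b b' f n m => Coend.sound (N := comp N P) f (Coend.mk p n) m) x)
    (by
      intro a d c c' f p x
      induction x using Coend.ind with | _ b n m
      exact congrArg (fun y => Coend.mk (N := comp N P) y m) (Coend.sound f p n))
    (by
      intro a d d' g c p x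
      induction x using Coend.ind
      rfl)
    (by
      intro a a' f d c p x
      induction x using Coend.ind
      rfl)
  inv := homMk (fun a d b x m =>
      Coend.desc (fun c p n => Coend.mk (M := comp M N) p (Coend.mk n m))
      (fun c c' f p n => Coend.sound (M := comp M N) f p (Coend.mk n m)) x)
    (by
      intro a d b b' f x m
      induction x using Coend.ind with | _ c p n
      exact congrArg (fun y => Coend.mk (M := comp M N) p y) (Coend.sound f n m))
    (by
      intro a d d' g c x m
      induction x using Coend.ind
      rfl)
    (by
      intro a a' f d c x m
      induction x using Coend.ind
      rfl)
  hom_inv_id := by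
    apply hom_ext
    intro a d c p x
    induction x using Coend.ind
    rfl
  inv_hom_id := by
    apply hom_ext
    intro a d b x m
    induction x using Coend.ind
    rfl

theorem mk_left (M : Profunctor.{u} A B) {a a' : A} (f : a' ⟶ a) {b : Bᵒᵖ}
    (m : (M.obj a').obj b) :
    Coend.mk (M := Profunctor.id) (N := M) (a := a) (b := a) ((M.map f).app b m) (𝟙 a) =
      Coend.mk (M := Profunctor.id) (N := M) (a := a) (b := a') m f :=
  (Coend.sound (M := Profunctor.id) (N := M) (a := a) f m (𝟙 a)).symm.trans
    (congrArg (Coend.mk (M := Profunctor.id) (N := M) (a := a) (b := a') m) (Category.comp_id f))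

theorem mk_right (M : Profunctor.{u} A B) {a : A} {b b' : B} (g : b ⟶ b')
    (m : (M.obj a).obj (op b')) :
    Coend.mk (M := M) (N := Profunctor.id) (c := op b) (b := b) (𝟙 b) ((M.obj a).map g.op m) =
      Coend.mk (M := M) (N := Profunctor.id) (c := op b) (b := b') g m :=
  (Coend.sound (M := M) (N := Profunctor.id) (a := a) (c := op b) g (𝟙 b) m).trans
    (congrArg (fun x => Coend.mk (M := M) (N := Profunctor.id) (c := op b) (b := b') x m)
      (Category.id_comp g))

/-- `M ∘ id ≅ M`. -/
def leftUnit (M : Profunctor.{u} A B) : comp (Profunctor.id) M ≅ M where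
  hom := homMk (fun a b a' m (f : a' ⟶ a) => (M.map f).app b m)
    (by
      intro a b a' a'' f m (g : a'' ⟶ a)
      change (M.map (f ≫ g)).app b m = _
      simp)
    (by
      intro a b b' g a' m f
      exact NatTrans.naturality_apply _ _ _)
    (by
      intro a a' g b a'' m (f : a'' ⟶ a)
      change (M.map (f ≫ g)).app b m = _
      simp)
  inv :=
    { app a :=
        { app b := ↾fun m => Coend.mk (M := Profunctor.id) (N := M) m (𝟙 a)
          naturality b b' g := by ext m; rfl }
      naturality a a' f := by
        ext b m
        exact (mk_left M f m).trans
          (congrArg (Coend.mk (M := Profunctor.id) (N := M) m) (Category.id_comp f).symm) }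
  hom_inv_id := hom_ext fun a b a' m f => mk_left M f m
  inv_hom_id := by
    ext a b m
    change (M.map (𝟙 a)).app b m = m
    simp

/-- `id ∘ M ≅ M`. -/
def rightUnit (M : Profunctor.{u} A B) : comp M (Profunctor.id) ≅ M where
  hom := homMk (fun a b b' (g : b.unop ⟶ b') m => (M.obj a).map g.op m)
    (by
      intro a b a' a'' f (g : b.unop ⟶ a') m
      change _ = (M.obj a).map (g ≫ f).op m
      simp)
    (by
      intro a b b' g a' (f : b.unop ⟶ a') m
      change (M.obj a).map (g.unop ≫ f).op m = _
      simp)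
    (by
      intro a a' f b b' g m
      exact (NatTrans.naturality_apply _ _ _).symm)
  inv :=
    { app a :=
        { app b := ↾fun m => Coend.mk (M := M) (N := Profunctor.id) (b := b.unop) (𝟙 b.unop) m
          naturality b b' g := by
            ext m
            exact (mk_right M g.unop m).trans (congrArg
              (fun x => Coend.mk (M := M) (N := Profunctor.id) (c := b') (b := b.unop) x m)
              (Category.comp_id g.unop).symm) }
      naturality a a' f := by
        ext b m
        rfl }
  hom_inv_id := hom_ext fun a b b' g m => mk_right M g m
  inv_hom_id := by
    ext a b m
    change (M.obj a).map (𝟙 b) m = m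
    simp

end Composition

/-- The bicategory of small categories, distributors and natural transformations. -/
instance : Bicategory DIST.{u} where
  Hom A B := Profunctor.{u} A B
  id A := Profunctor.id
  comp M N := comp M N
  whiskerLeft M _ _ θ := whiskerL M θ
  whiskerRight θ N := whiskerR θ N
  associator M N P := assoc M N P
  leftUnitor M := leftUnit M
  rightUnitor M := rightUnit M
  whiskerLeft_id _ _ := by apply hom_ext; intros; rfl
  whiskerLeft_comp _ _ _ _ _ _ := by apply hom_ext; intros; rfl
  id_whiskerRight _ _ := by apply hom_ext; intros; rfl
  comp_whiskerRight _ _ _ := by apply hom_ext; intros; rfl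
  id_whiskerLeft {A B M M'} θ := hom_ext fun a b a' m (f : a' ⟶ a) =>
    (mk_left M' f _).symm.trans (congrArg
      (fun x => Coend.mk (M := Profunctor.id) (N := M') (a := a) (b := a) x (𝟙 a))
      (naturality_left θ f b m).symm)
  comp_whiskerLeft _ _ _ _ _ := by
    apply hom_ext
    intro a c b n x
    induction x using Coend.ind
    rfl
  whiskerRight_id {A B M M'} θ := hom_ext fun a b b' (g : b.unop ⟶ b') m =>
    (mk_right M' g _).symm.trans (congrArg
      (fun x => Coend.mk (M := M') (N := Profunctor.id) (c := b) (b := b.unop) (𝟙 b.unop) x)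
      (naturality_right θ a g.op m).symm)
  whiskerRight_comp _ _ _ := by
    apply hom_ext
    intro a c b x m
    induction x using Coend.ind
    rfl
  whisker_assoc _ _ _ _ _ := by
    apply hom_ext
    intro a c b n x
    induction x using Coend.ind
    rfl
  whisker_exchange _ _ := by
    apply hom_ext
    intros
    rfl
  pentagon _ _ _ _ := by
    apply hom_ext
    intro a c b q x
    induction x using Coend.ind with | _ b p x
    induction x using Coend.ind
    rfl
  triangle M N := by
    apply hom_ext
    intro a c b n x
    induction x using Coend.ind with | _ b' g m
    exact (Coend.sound (M := M) (N := N) g n m).symm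

end DIST

namespace DIST

/-- The terminal category. -/
def unit : DIST.{u} := ⟨Discrete PUnit.{u + 1}⟩

end DIST

/-! ### The category obtained from a bicategory by identifying isomorphic 1-cells -/

section Ho
universe w v

/-- The category with the objects of the bicategory `B`, and with isomorphism classes of 1-cells
of `B` as morphisms. -/
structure Ho (B : Type u) : Type u where
  as : B

namespace Ho
variable {B : Type u} [Bicategory.{w, v} B]

instance : Category.{v} (Ho B) where
  Hom X Y := Quotient (isIsomorphicSetoid (X.as ⟶ Y.as))
  id X := Quotient.mk _ (𝟙 X.as)
  comp := Quotient.map₂ (fun f g => f ≫ g) (by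
    rintro f f' ⟨i⟩ g g' ⟨j⟩
    exact ⟨whiskerRightIso i g ≪≫ whiskerLeftIso f' j⟩)
  id_comp := by
    rintro X Y ⟨f⟩
    exact Quotient.sound ⟨λ_ f⟩
  comp_id := by
    rintro X Y ⟨f⟩
    exact Quotient.sound ⟨ρ_ f⟩
  assoc := by
    rintro X Y Z W ⟨f⟩ ⟨g⟩ ⟨h⟩
    exact Quotient.sound ⟨α_ f g h⟩

/-- The isomorphism class of a 1-cell. -/
def cls {X Y : B} (f : X ⟶ Y) : (⟨X⟩ : Ho B) ⟶ ⟨Y⟩ := Quotient.mk _ f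

/-- A functor between hom-categories acts on isomorphism classes. -/
def map₂ {X Y X' Y' Z W : B} (F : (X ⟶ Y) × (X' ⟶ Y') ⥤ (Z ⟶ W)) :
    ((⟨X⟩ : Ho B) ⟶ ⟨Y⟩) → ((⟨X'⟩ : Ho B) ⟶ ⟨Y'⟩) → ((⟨Z⟩ : Ho B) ⟶ ⟨W⟩) :=
  Quotient.map₂ (fun f g => F.obj (f, g)) (by
    rintro f f' ⟨i⟩ g g' ⟨j⟩
    exact ⟨F.mapIso (i.prod j)⟩)

end Ho
end Ho

/-! ### The bicategory of presheaves -/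

/-- A contravariant presheaf `R : 1 ⇸ A`, where `1` is the terminal category. -/
structure PSH : Type (u + 1) where
  base : DIST.{u}
  rel : DIST.unit ⟶ base

namespace PSH

/-- A 1-cell `R ⟶ S` consists of a distributor `M : A ⇸ B` and a 2-cell `M ∘ R ⇒ S`. -/
structure Hom (R S : PSH.{u}) : Type (u + 1) where
  dist : R.base ⟶ S.base
  cell : R.rel ≫ dist ⟶ S.rel

/-- A 2-cell `(M, α) ⟶ (N, β)` is a 2-cell `θ : M ⇒ N` with `β ∘ (θ R) = α`. -/
@[ext]
structure Hom₂ {R S : PSH.{u}} (f g : Hom R S) : Type u where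
  two : f.dist ⟶ g.dist
  w : R.rel ◁ two ≫ g.cell = f.cell := by cat_disch

attribute [simp] Hom₂.w

instance (R S : PSH.{u}) : Category (Hom R S) where
  Hom f g := Hom₂ f g
  id f := { two := 𝟙 f.dist }
  comp θ η := { two := θ.two ≫ η.two }

instance : CategoryStruct PSH.{u} where
  Hom R S := Hom R S
  id R := { dist := 𝟙 R.base, cell := (ρ_ R.rel).hom }
  comp {R _ _} f g :=
    { dist := f.dist ≫ g.dist
      cell := (α_ R.rel f.dist g.dist).inv ≫ f.cell ▷ g.dist ≫ g.cell }

instance (R S : PSH.{u}) : Category (R ⟶ S) := inferInstanceAs (Category (Hom R S))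

@[ext] theorem hom₂_ext {R S : PSH.{u}} {f g : R ⟶ S} {θ η : f ⟶ g} (h : θ.two = η.two) : θ = η :=
  Hom₂.ext h

@[simp] theorem id_two {R S : PSH.{u}} (f : R ⟶ S) : Hom₂.two (𝟙 f) = 𝟙 f.dist := rfl
@[simp] theorem comp_two {R S : PSH.{u}} {f g h : R ⟶ S} (θ : f ⟶ g) (η : g ⟶ h) :
    Hom₂.two (θ ≫ η) = θ.two ≫ η.two := rfl
@[simp] theorem comp_dist {R S T : PSH.{u}} (f : R ⟶ S) (g : S ⟶ T) :
    (f ≫ g).dist = f.dist ≫ g.dist := rfl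
@[simp] theorem id_dist (R : PSH.{u}) : Hom.dist (𝟙 R) = 𝟙 R.base := rfl
theorem comp_cell {R S T : PSH.{u}} (f : R ⟶ S) (g : S ⟶ T) :
    (f ≫ g).cell = (α_ R.rel f.dist g.dist).inv ≫ f.cell ▷ g.dist ≫ g.cell := rfl
theorem id_cell (R : PSH.{u}) : Hom.cell (𝟙 R) = (ρ_ R.rel).hom := rfl

/-- An invertible 2-cell of presheaves from an invertible 2-cell of distributors. -/
def isoMk {R S : PSH.{u}} {f g : R ⟶ S} (e : f.dist ≅ g.dist)
    (w : R.rel ◁ e.hom ≫ g.cell = f.cell) : f ≅ g where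
  hom := { two := e.hom, w := w }
  inv := { two := e.inv, w := by rw [← w]; simp [← Bicategory.whiskerLeft_comp_assoc] }
  hom_inv_id := hom₂_ext e.hom_inv_id
  inv_hom_id := hom₂_ext e.inv_hom_id

/-- The bicategory of presheaves. -/
instance : Bicategory PSH.{u} where
  homCategory R S := inferInstanceAs (Category (Hom R S))
  whiskerLeft f g h θ := Hom₂.mk (f.dist ◁ θ.two) (by
    change _ ◁ f.dist ◁ θ.two ≫ (α_ _ f.dist h.dist).inv ≫ f.cell ▷ h.dist ≫ h.cell =
      (α_ _ f.dist g.dist).inv ≫ f.cell ▷ g.dist ≫ g.cell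
    rw [← θ.w, Bicategory.associator_inv_naturality_right_assoc,
      Bicategory.whisker_exchange_assoc])
  whiskerRight {_ _ _ f g} θ h := Hom₂.mk (θ.two ▷ h.dist) (by
    change _ ◁ θ.two ▷ h.dist ≫ (α_ _ g.dist h.dist).inv ≫ g.cell ▷ h.dist ≫ h.cell =
      (α_ _ f.dist h.dist).inv ≫ f.cell ▷ h.dist ≫ h.cell
    rw [← θ.w, Bicategory.associator_inv_naturality_middle_assoc,
      Bicategory.comp_whiskerRight_assoc])
  associator f g h := isoMk (α_ f.dist g.dist h.dist) (by simp [comp_cell])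
  leftUnitor f := isoMk (λ_ f.dist) (by simp [comp_cell, id_cell])
  rightUnitor f := isoMk (ρ_ f.dist) (by simp [comp_cell, id_cell])
  whiskerLeft_id f g := hom₂_ext (Bicategory.whiskerLeft_id f.dist g.dist)
  whiskerLeft_comp f _ _ _ θ η := hom₂_ext (Bicategory.whiskerLeft_comp f.dist θ.two η.two)
  id_whiskerLeft θ := hom₂_ext (Bicategory.id_whiskerLeft θ.two)
  comp_whiskerLeft f g _ _ θ := hom₂_ext (Bicategory.comp_whiskerLeft f.dist g.dist θ.two)
  id_whiskerRight f g := hom₂_ext (Bicategory.id_whiskerRight f.dist g.dist)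
  comp_whiskerRight θ η f := hom₂_ext (Bicategory.comp_whiskerRight θ.two η.two f.dist)
  whiskerRight_id θ := hom₂_ext (Bicategory.whiskerRight_id θ.two)
  whiskerRight_comp θ f g := hom₂_ext (Bicategory.whiskerRight_comp θ.two f.dist g.dist)
  whisker_assoc f _ _ θ g := hom₂_ext (Bicategory.whisker_assoc f.dist θ.two g.dist)
  whisker_exchange θ η := hom₂_ext (Bicategory.whisker_exchange θ.two η.two)
  pentagon f g h i := hom₂_ext (Bicategory.pentagon f.dist g.dist h.dist i.dist)
  triangle f g := hom₂_ext (Bicategory.triangle f.dist g.dist)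

end PSH

namespace Ho
variable {B : Type*} [Bicategory B]

theorem cls_comp {X Y Z : B} (f : X ⟶ Y) (g : Y ⟶ Z) : cls f ≫ cls g = cls (f ≫ g) := rfl

/-- An isomorphism in `Ho B` from an equivalence in `B`. -/
def isoMk {X Y : B} (f : X ⟶ Y) (g : Y ⟶ X) (e : f ≫ g ≅ 𝟙 X) (e' : g ≫ f ≅ 𝟙 Y) :
    (⟨X⟩ : Ho B) ≅ ⟨Y⟩ where
  hom := cls f
  inv := cls g
  hom_inv_id := Quotient.sound ⟨e⟩
  inv_hom_id := Quotient.sound ⟨e'⟩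

end Ho

/-! ### The symmetric monoidal closed structure on distributors -/

namespace DIST

/-- The distributor `(b, a) ↦ hom(b, F a)` of a functor `F`. -/
def emb {A B : DIST.{u}} (F : A ⥤ B) : A ⟶ B := F.toProfunctor

theorem emb_sound {A B C : DIST.{u}} {F : A ⥤ B} {G : B ⥤ C} {a : A} {c : C} {b b' : B}
    (f : b ⟶ b') (n : c ⟶ G.obj b) (m : b' ⟶ F.obj a) {n' : c ⟶ G.obj b'} (hn : n ≫ G.map f = n')
    {m' : b ⟶ F.obj a} (hm : f ≫ m = m') :
    Coend.mk (M := emb F) (N := emb G) (c := op c) n m' =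
      Coend.mk (M := emb F) (N := emb G) (c := op c) n' m := by
  subst hn hm
  exact Coend.sound (M := emb F) (N := emb G) (c := op c) f n m

/-- If `G F ≅ id` then the distributor of `G` composed with that of `F` is the identity. -/
def embComp {A B : DIST.{u}} (F : A ⥤ B) (G : B ⥤ A) (e : F ⋙ G ≅ 𝟭 A) :
    emb F ≫ emb G ≅ 𝟙 A where
  hom := homMk (fun a c b (g : c.unop ⟶ G.obj b) (f : b ⟶ F.obj a) =>
      (g ≫ G.map f ≫ e.hom.app a : c.unop ⟶ a))
    (by
      intro a c b b' k (g : c.unop ⟶ G.obj b) (f : b' ⟶ F.obj a)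
      change g ≫ G.map (k ≫ f) ≫ e.hom.app a = (g ≫ G.map k) ≫ G.map f ≫ e.hom.app a
      simp)
    (by
      intro a c c' k b (g : c.unop ⟶ G.obj b) (f : b ⟶ F.obj a)
      exact Category.assoc k.unop g _)
    (by
      intro a a' k c b (g : c.unop ⟶ G.obj b) (f : b ⟶ F.obj a)
      change g ≫ G.map (f ≫ F.map k) ≫ e.hom.app a' = (g ≫ G.map f ≫ e.hom.app a) ≫ k
      have := e.hom.naturality k
      simp at this
      simp [this])
  inv := NatTrans.mk (fun a => NatTrans.mk (fun c => ↾fun (h : c.unop ⟶ a) =>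
        Coend.mk (M := emb F) (N := emb G) (b := F.obj a)
          (h ≫ e.inv.app a : c.unop ⟶ G.obj (F.obj a)) (𝟙 (F.obj a)))
      (by
        intro c c' k
        apply ConcreteCategory.hom_ext
        intro (h : c.unop ⟶ a)
        exact congrArg (fun x => Coend.mk (M := emb F) (N := emb G) (c := c') (b := F.obj a)
          x (𝟙 (F.obj a))) (Category.assoc k.unop h _)))
    (by
      intro a a' k
      apply NatTrans.ext
      funext c
      apply ConcreteCategory.hom_ext
      intro (h : c.unop ⟶ a)
      refine (emb_sound (F := F) (G := G) (F.map k) (h ≫ e.inv.app a) (𝟙 (F.obj a')) ?_ ?_).symm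
      · have := e.inv.naturality k
        simp at this
        change _ = (h ≫ k) ≫ e.inv.app a'
        simp [this]
      · change F.map k ≫ 𝟙 _ = 𝟙 _ ≫ F.map k
        simp)
  hom_inv_id := hom_ext fun a c b (g : c.unop ⟶ G.obj b) (f : b ⟶ F.obj a) => by
    refine (emb_sound (F := F) (G := G) f g (𝟙 (F.obj a)) ?_ ?_).symm
    · change _ = (g ≫ G.map f ≫ e.hom.app a) ≫ e.inv.app a
      simp
    · exact Category.comp_id f
  inv_hom_id := by
    apply NatTrans.ext
    funext a
    apply NatTrans.ext
    funext c
    apply ConcreteCategory.hom_ext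
    intro (h : c.unop ⟶ a)
    change (h ≫ e.inv.app a) ≫ G.map (𝟙 (F.obj a)) ≫ e.hom.app a = h
    simp

/-- An equivalence of categories is an isomorphism in the category of distributors. -/
def embEquiv {A B : DIST.{u}} (e : CategoryTheory.Equivalence A B) : (⟨A⟩ : Ho DIST.{u}) ≅ ⟨B⟩ :=
  Ho.isoMk (emb e.functor) (emb e.inverse) (embComp _ _ e.unitIso.symm) (embComp _ _ e.counitIso)

/-- The product of categories, which is the tensor product of distributors on objects. -/
def prod (A B : DIST.{u}) : DIST.{u} := ⟨A × B⟩

/-- The opposite category. -/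
def opp (A : DIST.{u}) : DIST.{u} := ⟨(A : Type u)ᵒᵖ⟩

/-- The tensor product `((c, d), (a, b)) ↦ M(c, a) × N(d, b)` of distributors. -/
def tensor {A B C D : DIST.{u}} (M : Profunctor.{u} A C) (N : Profunctor.{u} B D) :
    Profunctor.{u} (A × B) (C × D) where
  obj x :=
    { obj y := (M.obj x.1).obj (op y.unop.1) × (N.obj x.2).obj (op y.unop.2)
      map g := ↾fun p => ((M.obj x.1).map g.unop.1.op p.1, (N.obj x.2).map g.unop.2.op p.2)
      map_id y := by
        apply ConcreteCategory.hom_ext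
        intro p
        exact Prod.ext (Functor.map_id_apply (M.obj x.1) _ p.1)
          (Functor.map_id_apply (N.obj x.2) _ p.2)
      map_comp g h := by
        apply ConcreteCategory.hom_ext
        intro p
        exact Prod.ext (Functor.map_comp_apply (M.obj x.1) g.unop.1.op h.unop.1.op p.1)
          (Functor.map_comp_apply (N.obj x.2) g.unop.2.op h.unop.2.op p.2) }
  map f :=
    { app y := ↾fun p => ((M.map f.1).app _ p.1, (N.map f.2).app _ p.2)
      naturality y y' g := by
        apply ConcreteCategory.hom_ext
        intro p
        have h₁ := NatTrans.naturality_apply (M.map f.1) g.unop.1.op p.1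
        have h₂ := NatTrans.naturality_apply (N.map f.2) g.unop.2.op p.2
        exact Prod.ext h₁ h₂ }
  map_id x := by
    apply NatTrans.ext
    funext y
    apply ConcreteCategory.hom_ext
    intro p
    exact Prod.ext
      (ConcreteCategory.congr_hom (NatTrans.congr_app (M.map_id x.1) _) p.1)
      (ConcreteCategory.congr_hom (NatTrans.congr_app (N.map_id x.2) _) p.2)
  map_comp f g := by
    apply NatTrans.ext
    funext y
    apply ConcreteCategory.hom_ext
    intro p
    exact Prod.ext
      (ConcreteCategory.congr_hom (NatTrans.congr_app (M.map_comp f.1 g.1) _) p.1)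
      (ConcreteCategory.congr_hom (NatTrans.congr_app (N.map_comp f.2 g.2) _) p.2)

/-- The tensor product of 2-cells of distributors. -/
def tensor₂ {A B C D : DIST.{u}} {M M' : Profunctor.{u} A C} {N N' : Profunctor.{u} B D}
    (θ : M ⟶ M') (η : N ⟶ N') : tensor M N ⟶ tensor M' N' where
  app x :=
    { app y := ↾fun p => ((θ.app x.1).app (op y.unop.1) p.1, (η.app x.2).app (op y.unop.2) p.2)
      naturality y y' g := by
        apply ConcreteCategory.hom_ext
        intro p
        exact Prod.ext (naturality_right θ x.1 g.unop.1.op p.1)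
          (naturality_right η x.2 g.unop.2.op p.2) }
  naturality x x' f := by
    apply NatTrans.ext
    funext y
    apply ConcreteCategory.hom_ext
    intro p
    exact Prod.ext (naturality_left θ f.1 _ p.1) (naturality_left η f.2 _ p.2)

/-- The tensor product of distributors, as a functor between hom-categories. -/
def tensorFunctor (A B C D : DIST.{u}) : (A ⟶ C) × (B ⟶ D) ⥤ (prod A B ⟶ prod C D) where
  obj M := tensor M.1 M.2
  map θ := tensor₂ θ.1 θ.2

/-- The implication of distributors on objects: `A ⊸ B = Aᵒᵖ × B`. -/
def imp (A B : DIST.{u}) : DIST.{u} := prod (opp A) B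

/-- The evaluation, `(b', (a, (a', b))) ↦ hom(a', a) × hom(b', b)`. -/
def evalProf (A B : Type u) [SmallCategory A] [SmallCategory B] :
    Profunctor.{u} (A × (Aᵒᵖ × B)) B where
  obj x :=
    { obj b' := (x.2.1.unop ⟶ x.1) × (b'.unop ⟶ x.2.2)
      map g := ↾fun p => (p.1, g.unop ≫ p.2) }
  map f := { app b' := ↾fun p => (f.2.1.unop ≫ p.1 ≫ f.1, p.2 ≫ f.2.2) }

/-- The evaluation `A ⊗ (A ⊸ B) ⇸ B`. -/
def eval (A B : DIST.{u}) : prod A (imp A B) ⟶ B := evalProf A B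

/-- Uncurrying `M ↦ eval ∘ (id_A ⊗ M)`, as a functor between hom-categories. -/
def uncurryFunctor (A B C : DIST.{u}) : (B ⟶ imp A C) ⥤ (prod A B ⟶ C) :=
  Prod.sectR (𝟙 A) (B ⟶ imp A C) ⋙ tensorFunctor A B A (imp A C) ⋙ postcomp (prod A B) (eval A C)

/-- The tensor product, unit, associator and unitors of the category of distributors. -/
@[reducible] def monoidalStruct : MonoidalCategoryStruct (Ho DIST.{u}) where
  tensorObj X Y := ⟨prod X.as Y.as⟩
  tensorHom f g := Ho.map₂ (tensorFunctor _ _ _ _) f g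
  whiskerLeft X _ _ f := Ho.map₂ (tensorFunctor _ _ _ _) (𝟙 X) f
  whiskerRight f Y := Ho.map₂ (tensorFunctor _ _ _ _) f (𝟙 Y)
  tensorUnit := ⟨unit⟩
  associator X Y Z := embEquiv (prod.associativity X.as Y.as Z.as)
  leftUnitor X := embEquiv (prod.leftUnitorEquivalence X.as)
  rightUnitor X := embEquiv (prod.rightUnitorEquivalence X.as)

/-- The symmetry `A ⊗ B ≅ B ⊗ A`. -/
def braid (X Y : Ho DIST.{u}) : (⟨prod X.as Y.as⟩ : Ho DIST.{u}) ≅ ⟨prod Y.as X.as⟩ :=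
  embEquiv (Prod.braiding X.as Y.as)

end DIST

/-! ### The symmetric monoidal closed structure on presheaves -/

namespace PSH

/-- The values `R a` of a presheaf `R : 1 ⇸ A`, as a functor of `a`. -/
abbrev psh (R : PSH.{u}) : (R.base)ᵒᵖ ⥤ Type u := Functor.obj R.rel (⟨⟨⟩⟩ : Discrete PUnit)

/-- A functor `Aᵒᵖ ⥤ Type u`, as a distributor `1 ⇸ A`. -/
def ofPsh (A : DIST.{u}) (F : (A : Type u)ᵒᵖ ⥤ Type u) : PSH.{u} where
  base := A
  rel := (Functor.const (Discrete PUnit)).obj F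

/-- The profunctor underlying a 1-cell of distributors. -/
abbrev prof {A B : DIST.{u}} (M : A ⟶ B) : Profunctor.{u} A B := M

/-- A 2-cell `M ∘ R ⇒ S`, given on the representatives of the coend. -/
def cellMk {R S : PSH.{u}} {M : R.base ⟶ S.base}
    (φ : ∀ (a : R.base) (b : (S.base)ᵒᵖ),
      ((prof M).obj a).obj b → R.psh.obj (op a) → S.psh.obj b)
    (h : ∀ (a a' : R.base) (f : a ⟶ a') (b : (S.base)ᵒᵖ)
      (m : ((prof M).obj a).obj b) (r : R.psh.obj (op a')),
      φ a b m (R.psh.map f.op r) = φ a' b (((prof M).map f).app b m) r)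
    (hb : ∀ (a : R.base) (b b' : (S.base)ᵒᵖ) (g : b ⟶ b')
      (m : ((prof M).obj a).obj b) (r : R.psh.obj (op a)),
      φ a b' (((prof M).obj a).map g m) r = S.psh.map g (φ a b m r)) :
    R.rel ≫ M ⟶ S.rel :=
  DIST.homMk (fun _ b a m r => φ a b m r) (fun _ b a a' f m r => h a a' f b m r)
    (fun _ b b' g a m r => hb a b b' g m r)
    (by
      intro x x' f b a m r
      obtain rfl : x = x' := Discrete.ext (Discrete.eq_of_hom f)
      obtain rfl : f = 𝟙 x := rfl
      have h₁ : (prof R.rel).map (𝟙 x) = 𝟙 _ := CategoryTheory.Functor.map_id _ _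
      have h₂ : (prof S.rel).map (𝟙 x) = 𝟙 _ := CategoryTheory.Functor.map_id _ _
      change φ a b m (((prof R.rel).map (𝟙 x)).app (op a) r) =
        ((prof S.rel).map (𝟙 x)).app b (φ a b m r)
      rw [h₁, h₂]
      rfl)

/-- The 1-cell of presheaves over the distributor of a functor `F : A ⥤ B`, given by a natural
transformation `R ⟶ S ∘ F`. -/
def emb {R S : PSH.{u}} (F : R.base ⥤ S.base) (φ : R.psh ⟶ F.op ⋙ S.psh) : R ⟶ S where
  dist := DIST.emb F
  cell := cellMk (fun a b (g : b.unop ⟶ F.obj a) r => S.psh.map g.op (φ.app (op a) r))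
    (by
      intro a a' f b (g : b.unop ⟶ F.obj a) r
      change _ = S.psh.map (g ≫ F.map f).op _
      rw [NatTrans.naturality_apply]
      simp)
    (by
      intro a b b' k (g : b.unop ⟶ F.obj a) r
      change S.psh.map (k.unop ≫ g).op _ = _
      simp)

theorem map_op_comp {C : Type u} [SmallCategory C] (F : Cᵒᵖ ⥤ Type u) {a b c : C} (f : a ⟶ b)
    (g : b ⟶ c) (x : F.obj (op c)) : F.map (f ≫ g).op x = F.map f.op (F.map g.op x) := by
  simp

theorem embInv_aux {R S : PSH.{u}} (e : CategoryTheory.Equivalence R.base S.base)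
    (φ : R.psh ≅ e.functor.op ⋙ S.psh) {a : R.base} {b : S.base} (f : b ⟶ e.functor.obj a)
    (r : R.psh.obj (op a)) :
    R.psh.map (e.inverse.map f ≫ e.unitIso.inv.app a).op r =
      φ.inv.app (op (e.inverse.obj b)) (S.psh.map (e.counitIso.hom.app b).op
        (S.psh.map f.op (φ.hom.app (op a) r))) := by
  have h := φ.hom.naturality_apply (e.inverse.map f ≫ e.unitIso.inv.app a).op r
  have h' : e.functor.map (e.inverse.map f ≫ e.unitIso.inv.app a) =
      e.counitIso.hom.app b ≫ f := by simp
  have h'' := φ.hom_inv_id_app_apply _ (R.psh.map (e.inverse.map f ≫ e.unitIso.inv.app a).op r)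
  refine h''.symm.trans (congrArg (φ.inv.app (op (e.inverse.obj b))) (h.trans ?_))
  exact (congrArg (fun k => S.psh.map (Quiver.Hom.op k) (φ.hom.app (op a) r)) h').trans
    (map_op_comp _ _ _ _)

/-- An equivalence of categories, together with an isomorphism of presheaves over it, is an
isomorphism in the category of presheaves. -/
def embEquiv {R S : PSH.{u}} (e : CategoryTheory.Equivalence R.base S.base)
    (φ : R.psh ≅ e.functor.op ⋙ S.psh) : (⟨R⟩ : Ho PSH.{u}) ≅ ⟨S⟩ :=
  Ho.isoMk (emb e.functor φ.hom)
    (emb e.inverse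
      { app b := S.psh.map (e.counitIso.hom.app b.unop).op ≫ φ.inv.app (op (e.inverse.obj b.unop))
        naturality := by
          intro b b' f
          have h₁ := e.counitIso.hom.naturality f.unop
          have h₂ := φ.inv.naturality (e.inverse.map f.unop).op
          dsimp at h₁ h₂ ⊢
          rw [← Category.assoc, ← Functor.map_comp, Category.assoc, ← h₂, ← Category.assoc,
            ← Functor.map_comp]
          congr 2
          exact (congrArg Quiver.Hom.op h₁).symm })
    (isoMk (DIST.embComp _ _ e.unitIso.symm) (by
      apply DIST.hom_ext
      intro x c a m r
      induction m using DIST.Coend.ind with | _ b g f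
      change R.psh.map (g ≫ e.inverse.map f ≫ e.unitIso.inv.app a).op r =
        R.psh.map (Quiver.Hom.op g) ((S.psh.map (e.counitIso.hom.app _).op ≫ φ.inv.app _)
          (S.psh.map (Quiver.Hom.op f) (φ.hom.app (op a) r)))
      exact (map_op_comp R.psh g _ r).trans
        (congrArg (R.psh.map (Quiver.Hom.op g)) (embInv_aux e φ f r))))
    (isoMk (DIST.embComp _ _ e.counitIso) (by
      apply DIST.hom_ext
      intro x c b m s
      induction m using DIST.Coend.ind with | _ a g f
      change S.psh.map (g ≫ e.functor.map f ≫ e.counitIso.hom.app b).op s =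
        S.psh.map (Quiver.Hom.op g) (φ.hom.app _ (R.psh.map (Quiver.Hom.op f)
          ((S.psh.map (e.counitIso.hom.app _).op ≫ φ.inv.app _) s)))
      have h := φ.hom.naturality_apply (Quiver.Hom.op f)
        (φ.inv.app _ (S.psh.map (e.counitIso.hom.app b).op s))
      refine Eq.trans ?_ (congrArg (S.psh.map (Quiver.Hom.op g)) h.symm)
      have h' : φ.hom.app _ (φ.inv.app _ (S.psh.map (e.counitIso.hom.app b).op s)) =
        S.psh.map (e.counitIso.hom.app b).op s :=
        φ.inv_hom_id_app_apply _ _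
      rw [h']
      exact (map_op_comp S.psh g _ s).trans
        (congrArg (S.psh.map (Quiver.Hom.op g)) (map_op_comp S.psh (e.functor.map f) _ s))))

/-- The unit, the terminal presheaf on the terminal category. -/
def unit : PSH.{u} := ofPsh DIST.unit ((Functor.const _).obj PUnit)

/-- The tensor product `(a, b) ↦ R a × S b` on `A × B`. -/
def tensorPsh {A B : Type u} [SmallCategory A] [SmallCategory B] (R : Aᵒᵖ ⥤ Type u)
    (S : Bᵒᵖ ⥤ Type u) : (A × B)ᵒᵖ ⥤ Type u where
  obj x := R.obj (op x.unop.1) × S.obj (op x.unop.2)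
  map f := ↾fun p => (R.map f.unop.1.op p.1, S.map f.unop.2.op p.2)

/-- The implication `(a, b) ↦ (R a → S b)` on `Aᵒᵖ × B`. -/
def impPsh {A B : Type u} [SmallCategory A] [SmallCategory B] (R : Aᵒᵖ ⥤ Type u)
    (S : Bᵒᵖ ⥤ Type u) : (Aᵒᵖ × B)ᵒᵖ ⥤ Type u where
  obj x := R.obj x.unop.1 → S.obj (op x.unop.2)
  map f := ↾fun φ r => S.map f.unop.2.op (φ (R.map f.unop.1 r))

/-- The tensor product of presheaves. -/
def tensorObj (R S : PSH.{u}) : PSH.{u} := ofPsh (DIST.prod R.base S.base) (tensorPsh R.psh S.psh)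

/-- The implication of presheaves. -/
def imp (R S : PSH.{u}) : PSH.{u} := ofPsh (DIST.imp R.base S.base) (impPsh R.psh S.psh)

/-- The tensor product of 1-cells of presheaves. -/
def tensor {R R' S S' : PSH.{u}} (f : R ⟶ R') (g : S ⟶ S') : tensorObj R S ⟶ tensorObj R' S' where
  dist := (DIST.tensorFunctor _ _ _ _).obj (f.dist, g.dist)
  cell := cellMk (fun a b m r =>
      (NatTrans.app (NatTrans.app f.cell ⟨⟨⟩⟩) (op b.unop.1)
        (DIST.Coend.mk (M := R.rel) (N := f.dist) (b := a.1) m.1 r.1),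
       NatTrans.app (NatTrans.app g.cell ⟨⟨⟩⟩) (op b.unop.2)
        (DIST.Coend.mk (M := S.rel) (N := g.dist) (b := a.2) m.2 r.2)))
    (by
      intro a a' k b m r
      exact Prod.ext
        (congrArg (NatTrans.app (NatTrans.app f.cell ⟨⟨⟩⟩) (op b.unop.1))
          (DIST.Coend.sound (M := R.rel) (N := f.dist) k.1 m.1 r.1))
        (congrArg (NatTrans.app (NatTrans.app g.cell ⟨⟨⟩⟩) (op b.unop.2))
          (DIST.Coend.sound (M := S.rel) (N := g.dist) k.2 m.2 r.2)))
    (by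
      intro a b b' k m r
      exact Prod.ext (DIST.naturality_right f.cell ⟨⟨⟩⟩ k.unop.1.op
          (DIST.Coend.mk (M := R.rel) (N := f.dist) (b := a.1) m.1 r.1))
        (DIST.naturality_right g.cell ⟨⟨⟩⟩ k.unop.2.op
          (DIST.Coend.mk (M := S.rel) (N := g.dist) (b := a.2) m.2 r.2)))

/-- The evaluation `R ⊗ (R ⊸ S) ⟶ S`, `((g, h), (r, φ)) ↦ S(h) (φ (R(g) r))`. -/
def eval (R S : PSH.{u}) : tensorObj R (imp R S) ⟶ S where
  dist := DIST.eval R.base S.base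
  cell := cellMk (fun a b m r => S.psh.map m.2.op (r.2 (R.psh.map m.1.op r.1)))
    (by
      intro a a' k b m r
      change S.psh.map m.2.op (S.psh.map k.2.2.op (r.2 (R.psh.map k.2.1 (R.psh.map m.1.op
        (R.psh.map k.1.op r.1))))) = S.psh.map (m.2 ≫ k.2.2).op (r.2 (R.psh.map
        (k.2.1.unop ≫ m.1 ≫ k.1).op r.1))
      simp
      rfl)
    (by
      intro a b b' k m r
      change S.psh.map (k.unop ≫ m.2).op _ = _
      simp
      rfl)

/-- The tensor product of 1-cells of presheaves, as a functor between hom-categories. -/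
def tensorFunctor (R S R' S' : PSH.{u}) :
    (R ⟶ R') × (S ⟶ S') ⥤ (tensorObj R S ⟶ tensorObj R' S') where
  obj f := tensor f.1 f.2
  map {f g} θ := Hom₂.mk (DIST.tensor₂ θ.1.two θ.2.two) (by
    apply DIST.hom_ext
    intro x b a m r
    have h₁ := ConcreteCategory.congr_hom
      (NatTrans.congr_app (NatTrans.congr_app θ.1.w ⟨⟨⟩⟩) (op b.unop.1))
      (DIST.Coend.mk (M := R.rel) (N := f.1.dist) (b := a.1) m.1 r.1)
    have h₂ := ConcreteCategory.congr_hom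
      (NatTrans.congr_app (NatTrans.congr_app θ.2.w ⟨⟨⟩⟩) (op b.unop.2))
      (DIST.Coend.mk (M := S.rel) (N := f.2.dist) (b := a.2) m.2 r.2)
    exact Prod.ext h₁ h₂)
  map_id f := rfl
  map_comp θ η := rfl

/-- Uncurrying `f ↦ eval ∘ (id_R ⊗ f)`, as a functor between hom-categories. -/
def uncurryFunctor (R S T : PSH.{u}) : (S ⟶ imp R T) ⥤ (tensorObj R S ⟶ T) :=
  Prod.sectR (𝟙 R) (S ⟶ imp R T) ⋙ tensorFunctor R S R (imp R T) ⋙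
    postcomp (tensorObj R S) (eval R T)

/-- The tensor product, unit, associator and unitors of the category of presheaves. -/
@[reducible] def monoidalStruct : MonoidalCategoryStruct (Ho PSH.{u}) where
  tensorObj X Y := ⟨tensorObj X.as Y.as⟩
  tensorHom f g := Ho.map₂ (tensorFunctor _ _ _ _) f g
  whiskerLeft X _ _ f := Ho.map₂ (tensorFunctor _ _ _ _) (𝟙 X) f
  whiskerRight f Y := Ho.map₂ (tensorFunctor _ _ _ _) f (𝟙 Y)
  tensorUnit := ⟨unit⟩
  associator X Y Z := embEquiv (prod.associativity X.as.base Y.as.base Z.as.base)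
    (NatIso.ofComponents (fun _ => (Equiv.prodAssoc _ _ _).toIso) (fun _ => rfl))
  leftUnitor X := embEquiv (prod.leftUnitorEquivalence X.as.base)
    (NatIso.ofComponents (fun _ => (Equiv.punitProd _).toIso) (fun _ => rfl))
  rightUnitor X := embEquiv (prod.rightUnitorEquivalence X.as.base)
    (NatIso.ofComponents (fun _ => (Equiv.prodPUnit _).toIso) (fun _ => rfl))

/-- The symmetry `R ⊗ S ≅ S ⊗ R`. -/
def braid (X Y : Ho PSH.{u}) :
    (⟨tensorObj X.as Y.as⟩ : Ho PSH.{u}) ≅ ⟨tensorObj Y.as X.as⟩ :=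
  embEquiv (Prod.braiding X.as.base Y.as.base)
    (NatIso.ofComponents (fun _ => (Equiv.prodComm _ _).toIso) (fun _ => rfl))

/-- The functor `p : PSH ⥤ DIST`. -/
def p : Ho PSH.{u} ⥤ Ho DIST.{u} where
  obj R := ⟨R.as.base⟩
  map := Quotient.map (fun f => f.dist) (by
    rintro f g ⟨e⟩
    exact ⟨⟨e.hom.two, e.inv.two, congrArg Hom₂.two e.hom_inv_id, congrArg Hom₂.two e.inv_hom_id⟩⟩)
  map_comp := by
    rintro R S T ⟨f⟩ ⟨g⟩
    rfl

end PSH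

end

/-! ### Monoidal categories with given structure, and preservation of implication -/

section

open CategoryTheory MonoidalCategory

/-- The given tensor product, unit, associator and unitors satisfy the axioms of a monoidal
category. -/
def IsMonoidal {C : Type*} [Category C] (S : MonoidalCategoryStruct C) : Prop :=
  ∃ m : MonoidalCategory C, m.toMonoidalCategoryStruct = S

/-- The monoidal category with the given structure. -/
@[reducible] def IsMonoidal.monoidalCategory {C : Type*} [Category C]
    {S : MonoidalCategoryStruct C} (h : IsMonoidal S) : MonoidalCategory C where
  toMonoidalCategoryStruct := S
  tensorHom_def := by obtain ⟨m, rfl⟩ := h; exact m.tensorHom_def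
  id_tensorHom_id := by obtain ⟨m, rfl⟩ := h; exact m.id_tensorHom_id
  tensorHom_comp_tensorHom := by obtain ⟨m, rfl⟩ := h; exact m.tensorHom_comp_tensorHom
  whiskerLeft_id := by obtain ⟨m, rfl⟩ := h; exact m.whiskerLeft_id
  id_whiskerRight := by obtain ⟨m, rfl⟩ := h; exact m.id_whiskerRight
  associator_naturality := by obtain ⟨m, rfl⟩ := h; exact m.associator_naturality
  leftUnitor_naturality := by obtain ⟨m, rfl⟩ := h; exact m.leftUnitor_naturality
  rightUnitor_naturality := by obtain ⟨m, rfl⟩ := h; exact m.rightUnitor_naturality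
  pentagon := by obtain ⟨m, rfl⟩ := h; exact m.pentagon
  triangle := by obtain ⟨m, rfl⟩ := h; exact m.triangle

/-- A monoidal functor preserves implication if the comparison morphism `F (X ⊸ Y) ⟶ F X ⊸ F Y`,
the transpose of `F X ⊗ F (X ⊸ Y) ≅ F (X ⊗ (X ⊸ Y)) ⟶ F Y`, is an isomorphism. -/
def PreservesImplication {C D : Type*} [Category C] [Category D] [MonoidalCategory C]
    [MonoidalCategory D] [MonoidalClosed C] [MonoidalClosed D] (F : C ⥤ D) [F.Monoidal] : Prop :=
  ∀ X Y : C, IsIso (MonoidalClosed.curry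
    (Functor.LaxMonoidal.μ F X ((ihom X).obj Y) ≫ F.map ((ihom.ev X).app Y)))

end

open CategoryTheory MonoidalCategory

/-!
Everything is reduced to computations with elements of coends. A 2-cell of distributors with
bijective components is invertible, so an equality of morphisms in `Ho DIST` or `Ho PSH` follows
from one comparison 2-cell that is bijective on elements (`PSH.cls_eq`) and, for presheaves,
respects the actions `PSH.Hom.act`.

The monoidal structure rests on two such comparisons. The interchange
`(N₁ ⊗ N₂) ∘ (M₁ ⊗ M₂) ⇒ (N₁ ∘ M₁) ⊗ (N₂ ∘ M₂)`, a coend over a product against a product of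
coends, makes the tensor product functorial (`DIST.interchange_bijective`). A square of 1-cells two
of whose sides come from functors `F`, `G`, with `G` an equivalence, commutes as soon as
`M(c, a) ≅ N(G c, F a)` (`PSH.Map.square`, by the co-Yoneda lemma); this yields naturality of the
associator, the unitors and the braiding. The coherence diagrams consist of 1-cells induced by
functors with transformations over them (`PSH.Map`), and these compose and tensor strictly, so that
the diagrams commute on the nose. All of this is done for presheaves; the axioms for distributors
are the images under `p` of the axioms for the terminal presheaves, over which every distributor
lies.

For the closed structure, `M ↦ ev ∘ (id ⊗ M)` is isomorphic, by co-Yoneda once more, to the ordinary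
currying equivalence between functors `B ⥤ (Aᵒᵖ × C)ᵒᵖ ⥤ Type` and `A × B ⥤ Cᵒᵖ ⥤ Type`
(`DIST.uncurryFunctorIso`). For presheaves, the action of a 1-cell `R ⊗ S ⟶ T` is curried along with
its distributor. Passing to isomorphism classes turns the equivalences of hom-categories into the
universal property of evaluation, hence into `MonoidalClosed` structures whose evaluations are the
prescribed ones; `p` maps one evaluation to the other, so it preserves implication. Finally
`A ⊸ B` is `Aᵒᵖ ⊗ B`, and its evaluation is the hom distributor `A ⊗ Aᵒᵖ ⇸ 1` tensored with `B`
(`DIST.dualEval_tensor`), so that `Aᵒᵖ` is a dual of `A` (`exactPairingOfBijective`).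
-/

/-! ### Invertible 2-cells, tested on elements -/

section
open Opposite

namespace DIST

/-- A 2-cell of distributors with bijective components is invertible. -/
noncomputable def isoOfBijective {A B : DIST.{u}} {M N : A ⟶ B} (θ : M ⟶ N)
    (h : ∀ (a : A) (b : (B : Type u)ᵒᵖ),
      Function.Bijective (NatTrans.app (NatTrans.app θ a) b)) : M ≅ N :=
  have : IsIso θ := by
    have (a : A) : IsIso (NatTrans.app θ a) := by
      have (b : (B : Type u)ᵒᵖ) : IsIso (NatTrans.app (NatTrans.app θ a) b) :=
        (isIso_iff_bijective _).2 (h a b)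
      exact NatIso.isIso_of_isIso_app _
    exact NatIso.isIso_of_isIso_app (F := PSH.prof M) (G := PSH.prof N) θ
  asIso θ

end DIST

namespace PSH

/-- The action `m, r ↦ α(m, r)` of a 1-cell `(M, α) : R ⟶ S` on representatives of the coend
`M ∘ R`. -/
def Hom.act {R S : PSH.{u}} (f : R ⟶ S) {a : R.base} {b : (S.base : Type u)ᵒᵖ}
    (m : ((prof f.dist).obj a).obj b) (r : R.psh.obj (op a)) : S.psh.obj b :=
  NatTrans.app (NatTrans.app f.cell ⟨⟨⟩⟩) b (DIST.Coend.mk (M := R.rel) (N := f.dist) m r)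

theorem Hom.act_map {R S : PSH.{u}} (f : R ⟶ S) {a a' : R.base} (k : a ⟶ a')
    {b : (S.base : Type u)ᵒᵖ} (m : ((prof f.dist).obj a).obj b) (r : R.psh.obj (op a')) :
    Hom.act f m (R.psh.map k.op r) = Hom.act f (((prof f.dist).map k).app b m) r :=
  congrArg (NatTrans.app (NatTrans.app f.cell ⟨⟨⟩⟩) b)
    (DIST.Coend.sound (M := R.rel) (N := f.dist) k m r)

theorem Hom.map_act {R S : PSH.{u}} (f : R ⟶ S) {a : R.base}
    {b b' : (S.base : Type u)ᵒᵖ} (k : b ⟶ b') (m : ((prof f.dist).obj a).obj b)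
    (r : R.psh.obj (op a)) :
    Hom.act f (((prof f.dist).obj a).map k m) r = S.psh.map k (Hom.act f m r) :=
  DIST.naturality_right f.cell ⟨⟨⟩⟩ k (DIST.Coend.mk (M := R.rel) (N := f.dist) m r)

/-- An invertible 2-cell of presheaves, from a 2-cell of distributors that is bijective on
elements and respects the actions. -/
noncomputable def isoOfBijective {R S : PSH.{u}} {f g : R ⟶ S} (θ : f.dist ⟶ g.dist)
    (h : ∀ (a : R.base) (b : (S.base : Type u)ᵒᵖ),
      Function.Bijective (NatTrans.app (NatTrans.app θ a) b))
    (w : ∀ (a : R.base) (b : (S.base : Type u)ᵒᵖ) (m : ((prof f.dist).obj a).obj b)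
      (r : R.psh.obj (op a)),
      Hom.act g (NatTrans.app (NatTrans.app θ a) b m) r = Hom.act f m r) : f ≅ g :=
  isoMk (DIST.isoOfBijective θ h) (DIST.hom_ext fun _ b a m r => w a b m r)

/-- Two 1-cells of presheaves define the same morphism if a 2-cell between their distributors is
bijective on elements and respects the actions. -/
theorem cls_eq {R S : PSH.{u}} {f g : R ⟶ S} (θ : f.dist ⟶ g.dist)
    (h : ∀ (a : R.base) (b : (S.base : Type u)ᵒᵖ),
      Function.Bijective (NatTrans.app (NatTrans.app θ a) b))
    (w : ∀ (a : R.base) (b : (S.base : Type u)ᵒᵖ) (m : ((prof f.dist).obj a).obj b)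
      (r : R.psh.obj (op a)),
      Hom.act g (NatTrans.app (NatTrans.app θ a) b m) r = Hom.act f m r) :
    Ho.cls f = Ho.cls g :=
  Quotient.sound ⟨isoOfBijective θ h w⟩

end PSH

/-! ### Functoriality of the tensor product -/

namespace DIST

/-- The comparison `(N₁ ⊗ N₂) ∘ (M₁ ⊗ M₂) ⇒ (N₁ ∘ M₁) ⊗ (N₂ ∘ M₂)`. -/
def interchange {A₁ A₂ B₁ B₂ C₁ C₂ : DIST.{u}} (M₁ : A₁ ⟶ B₁) (M₂ : A₂ ⟶ B₂) (N₁ : B₁ ⟶ C₁)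
    (N₂ : B₂ ⟶ C₂) :
    (tensorFunctor _ _ _ _).obj (M₁, M₂) ≫ (tensorFunctor _ _ _ _).obj (N₁, N₂) ⟶
      (tensorFunctor _ _ _ _).obj (M₁ ≫ N₁, M₂ ≫ N₂) :=
  homMk (fun _ _ _ n m => (Coend.mk (M := M₁) (N := N₁) n.1 m.1,
      Coend.mk (M := M₂) (N := N₂) n.2 m.2))
    (fun _ _ _ _ f n m => Prod.ext (Coend.sound (M := M₁) (N := N₁) f.1 n.1 m.1)
      (Coend.sound (M := M₂) (N := N₂) f.2 n.2 m.2))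
    (fun _ _ _ _ _ _ _ => rfl) (fun _ _ _ _ _ _ _ => rfl)

/-- The inverse is obtained by descending to the two coends one after the other. -/
theorem interchange_bijective {A₁ A₂ B₁ B₂ C₁ C₂ : DIST.{u}} (M₁ : A₁ ⟶ B₁) (M₂ : A₂ ⟶ B₂)
    (N₁ : B₁ ⟶ C₁) (N₂ : B₂ ⟶ C₂) (a : prod A₁ A₂) (c : (prod C₁ C₂ : Type u)ᵒᵖ) :
    Function.Bijective (NatTrans.app (NatTrans.app (interchange M₁ M₂ N₁ N₂) a) c) := by
  -- The inverse for a fixed representative of the second factor.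
  let inv₁ (b₂ : B₂) (n₂ : ((PSH.prof N₂).obj b₂).obj (op c.unop.2))
      (m₂ : ((PSH.prof M₂).obj a.2).obj (op b₂)) (x : Coend M₁ N₁ a.1 (op c.unop.1)) :
      Coend (tensor M₁ M₂) (tensor N₁ N₂) a c :=
    Coend.desc (fun b₁ n₁ m₁ => Coend.mk (M := tensor M₁ M₂) (N := tensor N₁ N₂) (a := a) (c := c)
      (b := (b₁, b₂)) (n₁, n₂) (m₁, m₂)) (by
        intro b b' f n m
        have := Coend.sound (M := tensor M₁ M₂) (N := tensor N₁ N₂) (a := a) (c := c)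
          (b := (b, b₂)) (b' := (b', b₂)) (Prod.mkHom f (𝟙 b₂)) (n, n₂) (m, m₂)
        have h₁ : ((PSH.prof M₂).obj a.2).map (𝟙 b₂).op m₂ = m₂ :=
          Functor.map_id_apply ((PSH.prof M₂).obj a.2) _ m₂
        have h₂ : ((PSH.prof N₂).map (𝟙 b₂)).app _ n₂ = n₂ :=
          ConcreteCategory.congr_hom (NatTrans.congr_app ((PSH.prof N₂).map_id b₂) _) n₂
        refine Eq.trans ?_ (this.trans ?_)
        · exact congrArg (fun z => Coend.mk (M := tensor M₁ M₂) (N := tensor N₁ N₂) (a := a)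
            (c := c) (b := (b, b₂)) (n, n₂) (((PSH.prof M₁).obj a.1).map f.op m, z)) h₁.symm
        · exact congrArg (fun z => Coend.mk (M := tensor M₁ M₂) (N := tensor N₁ N₂) (a := a)
            (c := c) (b := (b', b₂)) (((PSH.prof N₁).map f).app _ n, z) (m, m₂)) h₂) x
  let inv (x : Coend M₁ N₁ a.1 (op c.unop.1)) (y : Coend M₂ N₂ a.2 (op c.unop.2)) :
      Coend (tensor M₁ M₂) (tensor N₁ N₂) a c :=
    Coend.desc (fun b₂ n₂ m₂ => inv₁ b₂ n₂ m₂ x) (by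
      intro b b' f n m
      induction x using Coend.ind with | _ b₁ n₁ m₁
      have := Coend.sound (M := tensor M₁ M₂) (N := tensor N₁ N₂) (a := a) (c := c)
        (b := (b₁, b)) (b' := (b₁, b')) (Prod.mkHom (𝟙 b₁) f) (n₁, n) (m₁, m)
      have h₁ : ((PSH.prof M₁).obj a.1).map (𝟙 b₁).op m₁ = m₁ :=
        Functor.map_id_apply ((PSH.prof M₁).obj a.1) _ m₁
      have h₂ : ((PSH.prof N₁).map (𝟙 b₁)).app _ n₁ = n₁ :=
        ConcreteCategory.congr_hom (NatTrans.congr_app ((PSH.prof N₁).map_id b₁) _) n₁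
      refine Eq.trans ?_ (this.trans ?_)
      · exact congrArg (fun z => Coend.mk (M := tensor M₁ M₂) (N := tensor N₁ N₂) (a := a)
          (c := c) (b := (b₁, b)) (n₁, n) (z, ((PSH.prof M₂).obj a.2).map f.op m)) h₁.symm
      · exact congrArg (fun z => Coend.mk (M := tensor M₁ M₂) (N := tensor N₁ N₂) (a := a)
          (c := c) (b := (b₁, b')) (z, ((PSH.prof N₂).map f).app _ n) (m₁, m)) h₂) y
  refine Function.bijective_iff_has_inverse.2 ⟨fun z => inv z.1 z.2, ?_, ?_⟩
  · intro x
    induction x using Coend.ind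
    rfl
  · rintro ⟨x, y⟩
    induction x using Coend.ind
    induction y using Coend.ind
    rfl

end DIST

namespace PSH

theorem tensor_comp {R₁ R₂ S₁ S₂ T₁ T₂ : PSH.{u}} (f₁ : R₁ ⟶ S₁) (f₂ : R₂ ⟶ S₂) (g₁ : S₁ ⟶ T₁)
    (g₂ : S₂ ⟶ T₂) :
    Ho.cls (tensor f₁ f₂ ≫ tensor g₁ g₂) = Ho.cls (tensor (f₁ ≫ g₁) (f₂ ≫ g₂)) :=
  cls_eq (DIST.interchange f₁.dist f₂.dist g₁.dist g₂.dist)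
    (DIST.interchange_bijective f₁.dist f₂.dist g₁.dist g₂.dist) (by
      intro a c x r
      induction x using DIST.Coend.ind
      rfl)

theorem tensor_id (R S : PSH.{u}) : Ho.cls (tensor (𝟙 R) (𝟙 S)) = Ho.cls (𝟙 (tensorObj R S)) :=
  cls_eq
    (NatTrans.mk (fun _ => NatTrans.mk (fun _ => ↾fun m => m) (fun _ _ _ => rfl))
      (fun _ _ _ => rfl))
    (fun _ _ => Function.bijective_id) (fun _ _ _ _ => rfl)

end PSH
/-! ### Distributors and presheaf morphisms induced by functors -/

namespace DIST

/-- The restriction `(b, a) ↦ N(b, F a)` of a distributor along a functor. -/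
def restrict {A B C : DIST.{u}} (F : A ⥤ B) (N : B ⟶ C) : A ⟶ C :=
  F ⋙ PSH.prof N

/-- The co-Yoneda comparison `N ∘ emb F ⇒ N(-, F -)`. -/
def embCompHom {A B C : DIST.{u}} (F : A ⥤ B) (N : B ⟶ C) : emb F ≫ N ⟶ restrict F N :=
  homMk (fun a c b n (f : b ⟶ F.obj a) => ((PSH.prof N).map f).app c n)
    (by
      intro a c b b' k n (f : b' ⟶ F.obj a)
      change ((PSH.prof N).map (k ≫ f)).app c n = _
      simp)
    (by
      intro a c c' k b n (f : b ⟶ F.obj a)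
      exact NatTrans.naturality_apply _ _ _)
    (by
      intro a a' k c b n (f : b ⟶ F.obj a)
      change ((PSH.prof N).map (f ≫ F.map k)).app c n = ((PSH.prof N).map (F.map k)).app c _
      simp)

/-- Every class of `N ∘ emb F` is represented over an identity. -/
theorem emb_mk {A B C : DIST.{u}} (F : A ⥤ B) (N : B ⟶ C) {a : A} {c : (C : Type u)ᵒᵖ} {b : B}
    (n : ((PSH.prof N).obj b).obj c) (f : b ⟶ F.obj a) :
    Coend.mk (M := emb F) (N := N) n f =
      Coend.mk (M := emb F) (N := N) (b := F.obj a) (((PSH.prof N).map f).app c n) (𝟙 (F.obj a)) :=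
  (congrArg (Coend.mk (M := emb F) (N := N) n) (Category.comp_id f).symm).trans
    (Coend.sound (M := emb F) (N := N) f n (𝟙 (F.obj a)))

theorem embCompHom_bijective {A B C : DIST.{u}} (F : A ⥤ B) (N : B ⟶ C) (a : A)
    (c : (C : Type u)ᵒᵖ) :
    Function.Bijective (NatTrans.app (NatTrans.app (embCompHom F N) a) c) := by
  refine Function.bijective_iff_has_inverse.2
    ⟨fun n => Coend.mk (M := emb F) (N := N) (b := F.obj a) n (𝟙 (F.obj a)), ?_, ?_⟩
  · intro x
    induction x using Coend.ind with | _ b n f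
    exact (emb_mk F N n f).symm
  · intro n
    exact ConcreteCategory.congr_hom (NatTrans.congr_app ((PSH.prof N).map_id (F.obj a)) c) n

/-- For a 2-cell `θ` with components `M(c, a) → N(G c, F a)`, the 2-cell
`emb G ∘ M ⇒ N(-, F -)`. -/
def squareHom {A B C D : DIST.{u}} {F : A ⥤ B} {G : C ⥤ D} {M : A ⟶ C} {N : B ⟶ D}
    (θ : PSH.prof M ⟶ (PSH.prof N).whiskerLeft₂ F G) : M ≫ emb G ⟶ restrict F N :=
  homMk (fun a d c (g : d.unop ⟶ G.obj c) m =>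
      ((PSH.prof N).obj (F.obj a)).map g.op ((θ.app a).app (op c) m))
    (by
      intro a d c c' k (g : d.unop ⟶ G.obj c) m
      have := naturality_right (B := C) θ a k.op m
      refine (congrArg (((PSH.prof N).obj (F.obj a)).map g.op) this).trans ?_
      exact (Functor.map_comp_apply ((PSH.prof N).obj (F.obj a)) _ _ _).symm)
    (by
      intro a d d' k c (g : d.unop ⟶ G.obj c) m
      exact Functor.map_comp_apply ((PSH.prof N).obj (F.obj a)) g.op k _)
    (by
      intro a a' k d c (g : d.unop ⟶ G.obj c) m
      have := naturality_left (B := C) θ k (op c) m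
      refine (congrArg (((PSH.prof N).obj (F.obj a')).map g.op) this).trans ?_
      exact (NatTrans.naturality_apply ((PSH.prof N).map (F.map k)) g.op _).symm)

theorem squareHom_bijective {A B C D : DIST.{u}} {F : A ⥤ B} {G : C ⥤ D} [G.IsEquivalence]
    {M : A ⟶ C} {N : B ⟶ D} (θ : PSH.prof M ⟶ (PSH.prof N).whiskerLeft₂ F G)
    (h : ∀ (a : A) (c : C), Function.Bijective ((θ.app a).app (op c))) (a : A)
    (d : (D : Type u)ᵒᵖ) :
    Function.Bijective (NatTrans.app (NatTrans.app (squareHom θ) a) d) := by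
  obtain ⟨c₀, ⟨e⟩⟩ : ∃ c₀, Nonempty (d.unop ≅ G.obj c₀) :=
    ⟨_, ⟨(G.objObjPreimageIso d.unop).symm⟩⟩
  -- Since `G` is essentially surjective and full, every class is represented over `e`.
  have key (x : Coend M (emb G) a d) :
      ∃ m, x = Coend.mk (M := M) (N := emb G) (c := d) (b := c₀) e.hom m := by
    induction x using Coend.ind with | _ c g m
    change d.unop ⟶ G.obj c at g
    refine ⟨((PSH.prof M).obj a).map (G.preimage (e.inv ≫ g)).op m, ?_⟩
    refine Eq.trans ?_ (Coend.sound (M := M) (N := emb G) (c := d) (G.preimage (e.inv ≫ g))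
      e.hom m).symm
    refine congrArg (fun z => Coend.mk (M := M) (N := emb G) (c := d) z m) ?_
    change g = e.hom ≫ G.map _
    simp
  have hb : Function.Bijective (((PSH.prof N).obj (F.obj a)).map e.hom.op) :=
    (isIso_iff_bijective _).1 inferInstance
  constructor
  · intro x y hxy
    obtain ⟨m, rfl⟩ := key x
    obtain ⟨m', rfl⟩ := key y
    exact congrArg (Coend.mk (M := M) (N := emb G) (c := d) (b := c₀) e.hom)
      ((h a c₀).1 (hb.1 hxy))
  · intro n
    obtain ⟨n', hn⟩ := hb.2 n
    obtain ⟨m, hm⟩ := (h a c₀).2 n'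
    exact ⟨Coend.mk (M := M) (N := emb G) (c := d) (b := c₀) e.hom m,
      (congrArg (((PSH.prof N).obj (F.obj a)).map e.hom.op) hm).trans hn⟩

end DIST

namespace PSH

/-- A functor between the base categories of two presheaves with a natural transformation over
it; such a pair induces a 1-cell of presheaves by `PSH.emb`. -/
structure Map (R S : PSH.{u}) where
  functor : R.base ⥤ S.base
  trans : R.psh ⟶ functor.op ⋙ S.psh

namespace Map
variable {R S T R' S' : PSH.{u}}

/-- The 1-cell induced by a functor and a natural transformation over it. -/
def cell (f : Map R S) : R ⟶ S := emb f.functor f.trans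

/-- The identity functor with the identity transformation. -/
def id (R : PSH.{u}) : Map R R := ⟨𝟭 _, 𝟙 _⟩

/-- Composition of functors with transformations over them. -/
def comp (f : Map R S) (g : Map S T) : Map R T :=
  ⟨f.functor ⋙ g.functor, f.trans ≫ Functor.whiskerLeft f.functor.op g.trans⟩

/-- Tensor product of functors with transformations over them. -/
def tensor (f : Map R S) (g : Map R' S') : Map (tensorObj R R') (tensorObj S S') where
  functor := f.functor.prod g.functor
  trans :=
    { app x := ↾fun p => (f.trans.app (op x.unop.1) p.1, g.trans.app (op x.unop.2) p.2)
      naturality x y k := by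
        apply ConcreteCategory.hom_ext
        intro p
        have h₁ := NatTrans.naturality_apply f.trans k.unop.1.op p.1
        have h₂ := NatTrans.naturality_apply g.trans k.unop.2.op p.2
        exact Prod.ext h₁ h₂ }

/-- Precomposition of a 1-cell of presheaves with a functor and a transformation over it. -/
def restrict (f : Map R S) (g : S ⟶ T) : R ⟶ T where
  dist := DIST.restrict f.functor g.dist
  cell := cellMk (fun _ _ m r => Hom.act g m (f.trans.app (op _) r))
    (by
      intro a a' k b m r
      rw [NatTrans.naturality_apply]
      exact Hom.act_map g (f.functor.map k) m _)
    (fun _ _ _ k m _ => Hom.map_act g k m _)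

/-- The co-Yoneda lemma for 1-cells of presheaves. -/
theorem cell_comp_cls (f : Map R S) (g : S ⟶ T) :
    Ho.cls (f.cell ≫ g) = Ho.cls (f.restrict g) :=
  cls_eq (DIST.embCompHom f.functor g.dist) (DIST.embCompHom_bijective f.functor g.dist) (by
    intro a c x r
    induction x using DIST.Coend.ind with | _ b n k
    change b ⟶ f.functor.obj a at k
    exact (Hom.act_map g k n _).symm)

/-- A square of 1-cells with functors on two sides commutes up to isomorphism, if its distributors
satisfy `M(c, a) ≅ N(G c, F a)` naturally, compatibly with the actions on presheaves. -/
theorem square {f : R ⟶ R'} {g : S ⟶ S'} (φ : Map R S) (ψ : Map R' S')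
    [ψ.functor.IsEquivalence]
    (θ : prof f.dist ⟶ (prof g.dist).whiskerLeft₂ φ.functor ψ.functor)
    (h : ∀ (a : R.base) (c : R'.base), Function.Bijective ((θ.app a).app (op c)))
    (w : ∀ (a : R.base) (c : R'.base) (m : ((prof f.dist).obj a).obj (op c))
      (r : R.psh.obj (op a)), Hom.act g (b := op (ψ.functor.obj c)) ((θ.app a).app (op c) m)
        (φ.trans.app (op a) r) = ψ.trans.app (op c) (Hom.act f m r)) :
    Ho.cls f ≫ Ho.cls ψ.cell = Ho.cls φ.cell ≫ Ho.cls g := by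
  refine Eq.trans ?_ (φ.cell_comp_cls g).symm
  refine cls_eq (f := f ≫ ψ.cell) (g := φ.restrict g) (DIST.squareHom θ)
    (DIST.squareHom_bijective θ h) ?_
  intro a d x r
  induction x using DIST.Coend.ind with | _ c k m
  change d.unop ⟶ ψ.functor.obj c at k
  exact (Hom.map_act g k.op _ _).trans (congrArg (S'.psh.map k.op) (w a c m r))

theorem cls_id : Ho.cls (𝟙 R) = Ho.cls (Map.id R).cell :=
  cls_eq
    (NatTrans.mk (fun _ => NatTrans.mk (fun _ => ↾fun m => m) (fun _ _ _ => rfl))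
      (fun _ _ _ => rfl))
    (fun _ _ => Function.bijective_id) (fun _ _ _ _ => rfl)

theorem cls_comp (f : Map R S) (g : Map S T) :
    Ho.cls f.cell ≫ Ho.cls g.cell = Ho.cls (f.comp g).cell :=
  (f.cell_comp_cls g.cell).trans (cls_eq
    (NatTrans.mk (fun _ => NatTrans.mk (fun _ => ↾fun m => m) (fun _ _ _ => rfl))
      (fun _ _ _ => rfl))
    (fun _ _ => Function.bijective_id) (fun _ _ _ _ => rfl))

theorem cls_tensor (f : Map R S) (g : Map R' S') :
    Ho.cls (PSH.tensor f.cell g.cell) = Ho.cls (f.tensor g).cell :=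
  cls_eq
    (NatTrans.mk (fun _ => NatTrans.mk (fun _ => ↾fun m => m) (fun _ _ _ => rfl))
      (fun _ _ _ => rfl))
    (fun _ _ => Function.bijective_id) (fun _ _ _ _ => rfl)

end Map

end PSH
/-! ### The symmetric monoidal category of presheaves -/

/-- The unit category is thin, so the first factor of `id ⊗ M` over it carries no information. -/
theorem DIST.unit_hom_ext {a b : DIST.unit.{u}} (f g : a ⟶ b) : f = g :=
  Discrete.instSubsingletonDiscreteHom (α := PUnit.{u + 1}) a b |>.elim f g

namespace PSH

namespace Map

/-- `(A × B) × C ⥤ A × (B × C)`, with `(R × S) × T → R × (S × T)` over it. -/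
def associator (R S T : PSH.{u}) :
    Map (tensorObj (tensorObj R S) T) (tensorObj R (tensorObj S T)) where
  functor := prod.associator R.base S.base T.base
  trans := { app _ := ↾fun p => (p.1.1, (p.1.2, p.2)) }

/-- `1 × A ⥤ A`, with `1 × R → R` over it. -/
def leftUnitor (R : PSH.{u}) : Map (tensorObj unit R) R where
  functor := prod.leftUnitor R.base
  trans := { app _ := ↾fun p => p.2 }

/-- `A × 1 ⥤ A`, with `R × 1 → R` over it. -/
def rightUnitor (R : PSH.{u}) : Map (tensorObj R unit) R where
  functor := prod.rightUnitor R.base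
  trans := { app _ := ↾fun p => p.1 }

/-- `A × B ⥤ B × A`, with `R × S → S × R` over it. -/
def braiding (R S : PSH.{u}) : Map (tensorObj R S) (tensorObj S R) where
  functor := CategoryTheory.Prod.swap R.base S.base
  trans := { app _ := ↾fun p => (p.2, p.1) }

instance (R S T : PSH.{u}) : (associator R S T).functor.IsEquivalence :=
  inferInstanceAs (prod.associator R.base S.base T.base).IsEquivalence

instance (R : PSH.{u}) : (leftUnitor R).functor.IsEquivalence :=
  inferInstanceAs (prod.leftUnitor R.base).IsEquivalence

instance (R : PSH.{u}) : (rightUnitor R).functor.IsEquivalence :=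
  inferInstanceAs (prod.rightUnitor R.base).IsEquivalence

instance (R S : PSH.{u}) : (braiding R S).functor.IsEquivalence :=
  inferInstanceAs (CategoryTheory.Prod.swap R.base S.base).IsEquivalence

end Map

variable {R S T R' S' T' : PSH.{u}}

theorem associator_naturality (f : R ⟶ R') (g : S ⟶ S') (h : T ⟶ T') :
    Ho.cls (tensor (tensor f g) h) ≫ Ho.cls (Map.associator R' S' T').cell =
      Ho.cls (Map.associator R S T).cell ≫ Ho.cls (tensor f (tensor g h)) :=
  Map.square (Map.associator R S T) (Map.associator R' S' T')
    (NatTrans.mk (fun _ => NatTrans.mk (fun _ => ↾fun p => (p.1.1, (p.1.2, p.2)))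
      (fun _ _ _ => rfl)) (fun _ _ _ => rfl))
    (fun _ _ => (Equiv.prodAssoc _ _ _).bijective) (fun _ _ _ _ => rfl)

theorem leftUnitor_naturality (f : R ⟶ S) :
    Ho.cls (tensor (𝟙 unit) f) ≫ Ho.cls (Map.leftUnitor S).cell =
      Ho.cls (Map.leftUnitor R).cell ≫ Ho.cls f :=
  Map.square (Map.leftUnitor R) (Map.leftUnitor S)
    (NatTrans.mk (fun _ => NatTrans.mk (fun _ => ↾fun p => p.2)
      (fun _ _ _ => rfl)) (fun _ _ _ => rfl))
    (fun a c => by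
      refine ⟨?_, fun m => ⟨(𝟙 (⟨⟨⟩⟩ : Discrete PUnit.{u + 1}), m), rfl⟩⟩
      rintro ⟨k, m⟩ ⟨k', m'⟩ hm
      exact Prod.ext (DIST.unit_hom_ext k k') hm)
    (fun _ _ _ _ => rfl)

theorem rightUnitor_naturality (f : R ⟶ S) :
    Ho.cls (tensor f (𝟙 unit)) ≫ Ho.cls (Map.rightUnitor S).cell =
      Ho.cls (Map.rightUnitor R).cell ≫ Ho.cls f :=
  Map.square (Map.rightUnitor R) (Map.rightUnitor S)
    (NatTrans.mk (fun _ => NatTrans.mk (fun _ => ↾fun p => p.1)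
      (fun _ _ _ => rfl)) (fun _ _ _ => rfl))
    (fun a c => by
      refine ⟨?_, fun m => ⟨(m, 𝟙 (⟨⟨⟩⟩ : Discrete PUnit.{u + 1})), rfl⟩⟩
      rintro ⟨m, k⟩ ⟨m', k'⟩ hm
      exact Prod.ext hm (DIST.unit_hom_ext k k'))
    (fun _ _ _ _ => rfl)

theorem braiding_naturality (f : R ⟶ R') (g : S ⟶ S') :
    Ho.cls (tensor f g) ≫ Ho.cls (Map.braiding R' S').cell =
      Ho.cls (Map.braiding R S).cell ≫ Ho.cls (tensor g f) :=
  Map.square (Map.braiding R S) (Map.braiding R' S')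
    (NatTrans.mk (fun _ => NatTrans.mk (fun _ => ↾fun p => (p.2, p.1))
      (fun _ _ _ => rfl)) (fun _ _ _ => rfl))
    (fun _ _ => (Equiv.prodComm _ _).bijective) (fun _ _ _ _ => rfl)

/-- A composite of isomorphism classes of 1-cells induced by functors is induced by a functor. -/
theorem cls_comp_eq {x : (⟨R⟩ : Ho PSH.{u}) ⟶ ⟨S⟩} {y : (⟨S⟩ : Ho PSH.{u}) ⟶ ⟨T⟩}
    {f : Map R S} {g : Map S T} (hx : x = Ho.cls f.cell) (hy : y = Ho.cls g.cell) :
    x ≫ y = Ho.cls (f.comp g).cell := by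
  rw [hx, hy, Map.cls_comp]

theorem whiskerLeft_cls (f : Map S T) :
    Ho.cls (tensor (𝟙 R) f.cell) = Ho.cls ((Map.id R).tensor f).cell :=
  (congrArg (fun x => Ho.map₂ (tensorFunctor R S R T) x (Ho.cls f.cell))
    (Map.cls_id (R := R))).trans (Map.cls_tensor (Map.id R) f)

theorem whiskerRight_cls (f : Map S T) :
    Ho.cls (tensor f.cell (𝟙 R)) = Ho.cls (f.tensor (Map.id R)).cell :=
  (congrArg (fun x => Ho.map₂ (tensorFunctor S R T R) (Ho.cls f.cell) x)
    (Map.cls_id (R := R))).trans (Map.cls_tensor f (Map.id R))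

/-- Diagrams of 1-cells induced by functors commute if the underlying functors and transformations
agree; for the coherence diagrams below these agree definitionally. -/
theorem eq_of_map_eq {x y : (⟨R⟩ : Ho PSH.{u}) ⟶ ⟨S⟩} {f g : Map R S} (hx : x = Ho.cls f.cell)
    (hy : y = Ho.cls g.cell) (h : f = g) : x = y := by
  rw [hx, hy, h]

theorem pentagon (Q R S T : PSH.{u}) :
    Ho.cls (tensor (Map.associator Q R S).cell (𝟙 T)) ≫
      Ho.cls (Map.associator Q (tensorObj R S) T).cell ≫
        Ho.cls (tensor (𝟙 Q) (Map.associator R S T).cell) =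
      Ho.cls (Map.associator (tensorObj Q R) S T).cell ≫
        Ho.cls (Map.associator Q R (tensorObj S T)).cell :=
  eq_of_map_eq (cls_comp_eq (whiskerRight_cls _) (cls_comp_eq rfl (whiskerLeft_cls _)))
    (cls_comp_eq rfl rfl) rfl

theorem triangle (R S : PSH.{u}) :
    Ho.cls (Map.associator R unit S).cell ≫ Ho.cls (tensor (𝟙 R) (Map.leftUnitor S).cell) =
      Ho.cls (tensor (Map.rightUnitor R).cell (𝟙 S)) :=
  eq_of_map_eq (cls_comp_eq rfl (whiskerLeft_cls _)) (whiskerRight_cls _) rfl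

theorem hexagon (R S T : PSH.{u}) :
    Ho.cls (Map.associator R S T).cell ≫ Ho.cls (Map.braiding R (tensorObj S T)).cell ≫
        Ho.cls (Map.associator S T R).cell =
      Ho.cls (tensor (Map.braiding R S).cell (𝟙 T)) ≫ Ho.cls (Map.associator S R T).cell ≫
        Ho.cls (tensor (𝟙 S) (Map.braiding R T).cell) :=
  eq_of_map_eq (cls_comp_eq rfl (cls_comp_eq rfl rfl))
    (cls_comp_eq (whiskerRight_cls _) (cls_comp_eq rfl (whiskerLeft_cls _))) rfl

theorem symmetry (R S : PSH.{u}) :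
    Ho.cls (Map.braiding R S).cell ≫ Ho.cls (Map.braiding S R).cell = Ho.cls (𝟙 (tensorObj R S)) :=
  eq_of_map_eq (cls_comp_eq rfl rfl) Map.cls_id rfl

theorem isMonoidal : IsMonoidal PSH.monoidalStruct.{u} :=
  ⟨{ PSH.monoidalStruct.{u} with
      tensorHom_def := by
        rintro X Y X' Y' ⟨f⟩ ⟨g⟩
        refine Eq.trans ?_ (tensor_comp f (𝟙 _) (𝟙 _) g).symm
        exact congrArg₂ (Ho.map₂ (tensorFunctor _ _ _ _)) (Category.comp_id (Ho.cls f)).symm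
          (Category.id_comp (Ho.cls g)).symm
      id_tensorHom_id := fun X Y => tensor_id X.as Y.as
      tensorHom_comp_tensorHom := by
        rintro _ _ _ _ _ _ ⟨f₁⟩ ⟨f₂⟩ ⟨g₁⟩ ⟨g₂⟩
        exact tensor_comp f₁ f₂ g₁ g₂
      whiskerLeft_id := fun X Y => tensor_id X.as Y.as
      id_whiskerRight := fun X Y => tensor_id X.as Y.as
      associator_naturality := by
        rintro _ _ _ _ _ _ ⟨f⟩ ⟨g⟩ ⟨h⟩
        exact associator_naturality f g h
      leftUnitor_naturality := by
        rintro _ _ ⟨f⟩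
        exact leftUnitor_naturality f
      rightUnitor_naturality := by
        rintro _ _ ⟨f⟩
        exact rightUnitor_naturality f
      pentagon := fun W X Y Z => pentagon W.as X.as Y.as Z.as
      triangle := fun X Y => triangle X.as Y.as }, rfl⟩

end PSH
end

/-- A symmetric category from a braiding that is natural in both variables jointly; the second
hexagon is the inverse of the first. -/
@[reducible] def SymmetricCategory.ofBraiding {C : Type*} [Category C] [MonoidalCategory C]
    (b : ∀ X Y : C, X ⊗ Y ≅ Y ⊗ X)
    (naturality : ∀ {X X' Y Y' : C} (f : X ⟶ X') (g : Y ⟶ Y'),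
      (f ⊗ₘ g) ≫ (b X' Y').hom = (b X Y).hom ≫ (g ⊗ₘ f))
    (symmetry : ∀ X Y : C, (b X Y).hom ≫ (b Y X).hom = 𝟙 (X ⊗ Y))
    (hexagon : ∀ X Y Z : C, (α_ X Y Z).hom ≫ (b X (Y ⊗ Z)).hom ≫ (α_ Y Z X).hom =
      (b X Y).hom ▷ Z ≫ (α_ Y X Z).hom ≫ Y ◁ (b X Z).hom) : SymmetricCategory C where
  braiding := b
  braiding_naturality_right X Y Z f := by simpa using naturality (𝟙 X) f
  braiding_naturality_left f Z := by simpa using naturality f (𝟙 Z)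
  hexagon_forward := hexagon
  hexagon_reverse X Y Z := by
    have inv_eq (X Y : C) : inv (b X Y).hom = (b Y X).hom :=
      IsIso.inv_eq_of_hom_inv_id (symmetry X Y)
    have h : inv ((α_ Z X Y).hom ≫ (b Z (X ⊗ Y)).hom ≫ (α_ X Y Z).hom) =
      inv ((b Z X).hom ▷ Y ≫ (α_ X Z Y).hom ≫ X ◁ (b Z Y).hom) := by
      simp only [hexagon Z X Y]
    simpa [inv_eq] using h
  symmetry := symmetry

section
open Opposite

namespace PSH

/-- The symmetry of the monoidal category of presheaves. -/
@[reducible] def symmetricCategory :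
    letI := isMonoidal.{u}.monoidalCategory
    SymmetricCategory (Ho PSH.{u}) :=
  letI := isMonoidal.{u}.monoidalCategory
  SymmetricCategory.ofBraiding braid
    (by
      rintro _ _ _ _ ⟨f⟩ ⟨g⟩
      exact braiding_naturality f g)
    (fun X Y => symmetry X.as Y.as)
    (fun X Y Z => hexagon X.as Y.as Z.as)

/-! ### The symmetric monoidal category of distributors -/

/-- The terminal presheaf on `A`. -/
def terminal (A : DIST.{u}) : PSH.{u} := ofPsh A ((Functor.const _).obj PUnit)

/-- The unique 1-cell of terminal presheaves over a distributor. -/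
def terminalMap {A B : DIST.{u}} (M : A ⟶ B) : terminal A ⟶ terminal B where
  dist := M
  cell := cellMk (R := terminal A) (S := terminal B) (fun _ _ _ _ => ⟨⟩)
    (fun _ _ _ _ _ _ => rfl) (fun _ _ _ _ _ _ => rfl)

end PSH

namespace DIST
open PSH (p terminal terminalMap)

/-- The axioms are the images under `p` of the axioms for terminal presheaves: every distributor
underlies a 1-cell of terminal presheaves, and `p` preserves the structure definitionally. -/
theorem isMonoidal : IsMonoidal DIST.monoidalStruct.{u} :=
  ⟨{ DIST.monoidalStruct.{u} with
      tensorHom_def := by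
        rintro X Y X' Y' ⟨f⟩ ⟨g⟩
        exact congrArg p.map (PSH.isMonoidal.monoidalCategory.tensorHom_def
          (Ho.cls (terminalMap f)) (Ho.cls (terminalMap g)))
      id_tensorHom_id := fun X Y => congrArg p.map (PSH.tensor_id (terminal X.as) (terminal Y.as))
      tensorHom_comp_tensorHom := by
        rintro _ _ _ _ _ _ ⟨f₁⟩ ⟨f₂⟩ ⟨g₁⟩ ⟨g₂⟩
        exact congrArg p.map (PSH.tensor_comp (terminalMap f₁) (terminalMap f₂) (terminalMap g₁)
          (terminalMap g₂))
      whiskerLeft_id := fun X Y => congrArg p.map (PSH.tensor_id (terminal X.as) (terminal Y.as))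
      id_whiskerRight := fun X Y => congrArg p.map (PSH.tensor_id (terminal X.as) (terminal Y.as))
      associator_naturality := by
        rintro _ _ _ _ _ _ ⟨f⟩ ⟨g⟩ ⟨h⟩
        exact congrArg p.map
          (PSH.associator_naturality (terminalMap f) (terminalMap g) (terminalMap h))
      leftUnitor_naturality := by
        rintro _ _ ⟨f⟩
        exact congrArg p.map (PSH.leftUnitor_naturality (terminalMap f))
      rightUnitor_naturality := by
        rintro _ _ ⟨f⟩
        exact congrArg p.map (PSH.rightUnitor_naturality (terminalMap f))
      pentagon := fun W X Y Z => congrArg p.map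
        (PSH.pentagon (terminal W.as) (terminal X.as) (terminal Y.as) (terminal Z.as))
      triangle := fun X Y => congrArg p.map (PSH.triangle (terminal X.as) (terminal Y.as)) }, rfl⟩

/-- The symmetry of the monoidal category of distributors. -/
@[reducible] def symmetricCategory :
    letI := isMonoidal.{u}.monoidalCategory
    SymmetricCategory (Ho DIST.{u}) :=
  letI := isMonoidal.{u}.monoidalCategory
  SymmetricCategory.ofBraiding braid
    (by
      rintro _ _ _ _ ⟨f⟩ ⟨g⟩
      exact congrArg p.map (PSH.braiding_naturality (terminalMap f) (terminalMap g)))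
    (fun X Y => congrArg p.map (PSH.symmetry (terminal X.as) (terminal Y.as)))
    (fun X Y Z => congrArg p.map
      (PSH.hexagon (terminal X.as) (terminal Y.as) (terminal Z.as)))

end DIST

/-! ### The projection as a strict symmetric monoidal functor -/

namespace PSH

/-- The projection from presheaves to distributors is strict monoidal and preserves the
symmetry. -/
@[reducible] def braidedP :
    letI := DIST.isMonoidal.{u}.monoidalCategory
    letI := PSH.isMonoidal.{u}.monoidalCategory
    letI := DIST.symmetricCategory.{u}
    letI := PSH.symmetricCategory.{u}
    PSH.p.{u}.Braided :=
  letI := DIST.isMonoidal.{u}.monoidalCategory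
  letI := PSH.isMonoidal.{u}.monoidalCategory
  letI := DIST.symmetricCategory.{u}
  letI := PSH.symmetricCategory.{u}
  letI core : PSH.p.{u}.CoreMonoidal :=
    { εIso := Iso.refl _
      μIso := fun _ _ => Iso.refl _
      μIso_hom_natural_left := by
        rintro X Y ⟨f⟩ Z
        exact (Category.comp_id _).trans (Category.id_comp _).symm
      μIso_hom_natural_right := by
        rintro X Y Z ⟨f⟩
        exact (Category.comp_id _).trans (Category.id_comp _).symm
      associativity := fun X Y Z => by
        have (f : (p.obj X ⊗ p.obj Y) ⊗ p.obj Z ⟶ p.obj X ⊗ p.obj Y ⊗ p.obj Z) :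
            𝟙 (p.obj X ⊗ p.obj Y) ▷ p.obj Z ≫ 𝟙 _ ≫ f =
              f ≫ p.obj X ◁ 𝟙 (p.obj Y ⊗ p.obj Z) ≫ 𝟙 _ := by simp
        exact this (p.map (α_ X Y Z).hom)
      left_unitality := fun X => by
        have (f : 𝟙_ _ ⊗ p.obj X ⟶ p.obj X) : f = 𝟙 (𝟙_ _) ▷ p.obj X ≫ 𝟙 _ ≫ f := by simp
        exact this (p.map (λ_ X).hom)
      right_unitality := fun X => by
        have (f : p.obj X ⊗ 𝟙_ _ ⟶ p.obj X) : f = p.obj X ◁ 𝟙 (𝟙_ _) ≫ 𝟙 _ ≫ f := by simp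
        exact this (p.map (ρ_ X).hom) }
  { core.toMonoidal with
    braided := fun X Y => (Category.id_comp _).trans (Category.comp_id _).symm }

end PSH
/-! ### Currying of distributors -/

namespace DIST

section Currying
variable (A B C : Type u) [SmallCategory A] [SmallCategory B] [SmallCategory C]

/-- Currying of functors, as an equivalence between distributors `B ⇸ Aᵒᵖ × C` and distributors
`A × B ⇸ C`. It sends `M` to `(c, (a, b)) ↦ M((a, c), b)`. -/
def curryingEquivalence : Profunctor.{u} B (Aᵒᵖ × C) ≌ Profunctor.{u} (A × B) C :=
  (((prodOpEquiv Aᵒᵖ (D := C)).trans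
    ((opOpEquivalence A).prod CategoryTheory.Equivalence.refl)).congrLeft.trans
      Functor.currying.symm).congrRight.trans (Functor.flipping.trans Functor.currying)

variable {A B C}

/-- A morphism of `(Aᵒᵖ × C)ᵒᵖ`, given by its components. -/
def impHom {a a' : A} {c c' : C} (f : a ⟶ a') (g : c' ⟶ c) :
    (op (op a, c) : (Aᵒᵖ × C)ᵒᵖ) ⟶ op (op a', c') :=
  Quiver.Hom.op (Prod.mkHom f.op g)

theorem map_impHom (F : (Aᵒᵖ × C)ᵒᵖ ⥤ Type u) {a a' a'' : A} {c c' c'' : C} (f : a ⟶ a')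
    (g : c' ⟶ c) (f' : a' ⟶ a'') (g' : c'' ⟶ c') (x : F.obj (op (op a, c))) :
    F.map (impHom f' g') (F.map (impHom f g) x) = F.map (impHom (f ≫ f') (g' ≫ g)) x :=
  (Functor.map_comp_apply F (impHom f g) (impHom f' g') x).symm

theorem map_impHom_id (F : (Aᵒᵖ × C)ᵒᵖ ⥤ Type u) {a : A} {c : C} (x : F.obj (op (op a, c))) :
    F.map (impHom (𝟙 a) (𝟙 c)) x = x :=
  Functor.map_id_apply F _ x

/-- The comparison `ev ∘ (id ⊗ M) ⇒ curryingEquivalence M`, which acts by `M` with a pair of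
morphisms of the evaluation. -/
def uncurryHom (M : Profunctor.{u} B (Aᵒᵖ × C)) :
    comp (tensor (A := ⟨A⟩) (B := ⟨B⟩) (C := ⟨A⟩) (D := ⟨Aᵒᵖ × C⟩) Profunctor.id M)
      (evalProf A C) ⟶ (curryingEquivalence A B C).functor.obj M :=
  homMk (fun x _ _ n m => (M.obj x.2).map (impHom (n.1 ≫ m.1) n.2) m.2)
    (by
      intro x c b b' f n m
      refine (map_impHom (M.obj x.2) f.2.1.unop f.2.2 (n.1 ≫ f.1 ≫ m.1) n.2 m.2).trans ?_
      refine congrArg (fun k => (M.obj x.2).map (impHom k (n.2 ≫ f.2.2)) m.2) ?_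
      change f.2.1.unop ≫ n.1 ≫ f.1 ≫ m.1 = (f.2.1.unop ≫ n.1 ≫ f.1) ≫ m.1
      exact ((Category.assoc f.2.1.unop _ _).trans
        (congrArg (f.2.1.unop ≫ ·) (Category.assoc n.1 f.1 m.1))).symm)
    (by
      intro x c c' g b n m
      refine Eq.trans ?_ (map_impHom (M.obj x.2) (n.1 ≫ m.1) n.2 (𝟙 x.1) g.unop m.2).symm
      exact congrArg (fun k => (M.obj x.2).map (impHom k (g.unop ≫ n.2)) m.2)
        (Category.comp_id (n.1 ≫ m.1)).symm)
    (by
      intro x x' f c b n m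
      refine (NatTrans.naturality_apply (M.map f.2) (impHom (n.1 ≫ m.1 ≫ f.1) n.2) m.2).symm.trans
        (congrArg ((M.map f.2).app (op (op x'.1, c.unop))) ?_)
      refine Eq.trans ?_ (map_impHom (M.obj x.2) (n.1 ≫ m.1) n.2 f.1 (𝟙 c.unop) m.2).symm
      rw [Category.id_comp]
      exact congrArg (fun k => (M.obj x.2).map (impHom k n.2) m.2)
        (Category.assoc n.1 m.1 f.1).symm)

/-- The coend relation of `ev ∘ (id ⊗ M)`, with the transported elements as free variables. -/
theorem uncurry_sound (M : Profunctor.{u} B (Aᵒᵖ × C)) {x : A × B} {c : Cᵒᵖ}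
    {a a₁ a' a₁' : A} {c₁ c₁' : C} (f : a ⟶ a') (f₁ : a₁' ⟶ a₁) (g : c₁ ⟶ c₁')
    (n : (a₁ ⟶ a) × (c.unop ⟶ c₁)) (n' : (a₁' ⟶ a') × (c.unop ⟶ c₁'))
    (m : (a ⟶ x.1) × (M.obj x.2).obj (op (op a₁, c₁)))
    (m' : (a' ⟶ x.1) × (M.obj x.2).obj (op (op a₁', c₁')))
    (hn : (f₁ ≫ n.1 ≫ f, n.2 ≫ g) = n')
    (hm : (f ≫ m'.1, (M.obj x.2).map (impHom f₁ g) m'.2) = m) :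
    (Coend.mk (M := tensor (A := ⟨A⟩) (B := ⟨B⟩) (C := ⟨A⟩) (D := ⟨Aᵒᵖ × C⟩) Profunctor.id M)
      (N := evalProf A C) (a := x) (c := c) (b := (a, (op a₁, c₁))) n m) =
    (Coend.mk (M := tensor (A := ⟨A⟩) (B := ⟨B⟩) (C := ⟨A⟩) (D := ⟨Aᵒᵖ × C⟩) Profunctor.id M)
      (N := evalProf A C) (a := x) (c := c) (b := (a', (op a₁', c₁'))) n' m') := by
  subst hn hm
  exact Coend.sound
    (M := tensor (A := ⟨A⟩) (B := ⟨B⟩) (C := ⟨A⟩) (D := ⟨Aᵒᵖ × C⟩) Profunctor.id M)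
    (N := evalProf A C) (a := x) (c := c) (b := (a, (op a₁, c₁))) (b' := (a', (op a₁', c₁')))
    (Prod.mkHom f (Prod.mkHom f₁.op g)) n m'

theorem uncurryHom_bijective (M : Profunctor.{u} B (Aᵒᵖ × C)) (x : A × B) (c : Cᵒᵖ) :
    Function.Bijective (((uncurryHom M).app x).app c) := by
  refine Function.bijective_iff_has_inverse.2 ⟨fun m => Coend.mk
    (M := tensor (A := ⟨A⟩) (B := ⟨B⟩) (C := ⟨A⟩) (D := ⟨Aᵒᵖ × C⟩) Profunctor.id M)
    (N := evalProf A C) (b := (x.1, (op x.1, c.unop))) (𝟙 x.1, 𝟙 c.unop) (𝟙 x.1, m), ?_, ?_⟩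
  · intro z
    induction z using Coend.ind with | _ b n m
    -- Move `m.1` into the hom of the evaluation, then both of its homs into `M`.
    refine (uncurry_sound M (𝟙 x.1) (n.1 ≫ m.1) n.2 _ (n.1 ≫ m.1, n.2) _ (𝟙 x.1, m.2)
      ?_ ?_).trans (uncurry_sound M m.1 (𝟙 b.2.1.unop) (𝟙 b.2.2) n _ m _ ?_ ?_).symm
    · simp
    · exact Prod.ext (Category.comp_id _) rfl
    · exact Prod.ext (Category.id_comp _) (Category.comp_id _)
    · exact Prod.ext (Category.comp_id _) (map_impHom_id (M.obj x.2) m.2)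
  · intro m
    refine Eq.trans ?_ (map_impHom_id (M.obj x.2) m)
    exact congrArg (fun k => (M.obj x.2).map (impHom k (𝟙 c.unop)) m) (Category.comp_id (𝟙 x.1))

end Currying

/-- The currying equivalence between hom-categories of distributors. -/
def homCurrying (A B C : DIST.{u}) : (B ⟶ imp A C) ≌ (prod A B ⟶ C) :=
  curryingEquivalence A B C

/-- The functor `M ↦ ev ∘ (id ⊗ M)` is isomorphic to the currying equivalence. -/
noncomputable def uncurryFunctorIso (A B C : DIST.{u}) :
    uncurryFunctor A B C ≅ (homCurrying A B C).functor :=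
  NatIso.ofComponents (fun M => isoOfBijective (A := prod A B) (B := C) (uncurryHom M)
      (uncurryHom_bijective M))
    (fun θ => hom_ext (A := prod A B) (B := prod A (imp A C)) (C := C)
      fun x _ _ n m => (naturality_right (B := imp A C) θ x.2 (impHom (n.1 ≫ m.1) n.2) m.2).symm)

theorem uncurryFunctor_isEquivalence (A B C : DIST.{u}) : (uncurryFunctor A B C).IsEquivalence :=
  Functor.isEquivalence_of_iso (uncurryFunctorIso A B C).symm

end DIST
theorem DIST.map_id_app {A B : DIST.{u}} (M : A ⟶ B) (a : A) (b : (B : Type u)ᵒᵖ)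
    (m : ((PSH.prof M).obj a).obj b) : ((PSH.prof M).map (𝟙 a)).app b m = m :=
  ConcreteCategory.congr_hom (NatTrans.congr_app ((PSH.prof M).map_id a) b) m

/-! ### Currying of presheaf morphisms -/

namespace PSH

/-- The action of an uncurried 1-cell, in terms of the original action and of evaluation. -/
theorem uncurryFunctor_act {R S T : PSH.{u}} (f : S ⟶ imp R T) {x : R.base × S.base}
    {c : (T.base : Type u)ᵒᵖ} {a₁ a₂ : R.base} {c₁ : T.base} (n : (a₂ ⟶ a₁) × (c.unop ⟶ c₁))
    (k : a₁ ⟶ x.1) (m : ((prof f.dist).obj x.2).obj (op (op a₂, c₁)))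
    (r : R.psh.obj (op x.1)) (s : S.psh.obj (op x.2)) :
    Hom.act ((uncurryFunctor R S T).obj f) (a := x) (b := c)
      (DIST.Coend.mk (M := DIST.tensor (A := R.base) (C := R.base) Profunctor.id f.dist)
        (N := DIST.eval R.base T.base) (b := (a₁, (op a₂, c₁))) n (k, m)) (r, s) =
      T.psh.map n.2.op (Hom.act (S := imp R T) f m s (R.psh.map n.1.op (R.psh.map k.op r))) := rfl

instance (R S T : PSH.{u}) : (uncurryFunctor R S T).Faithful where
  map_injective h :=
    have := DIST.uncurryFunctor_isEquivalence R.base S.base T.base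
    hom₂_ext ((DIST.uncurryFunctor R.base S.base T.base).map_injective (congrArg Hom₂.two h))

instance (R S T : PSH.{u}) : (uncurryFunctor R S T).Full where
  map_surjective {f g} η := by
    have := DIST.uncurryFunctor_isEquivalence R.base S.base T.base
    obtain ⟨θ, hθ⟩ := this.full.map_surjective
      (X := f.dist) (Y := g.dist) η.two
    refine ⟨Hom₂.mk θ (DIST.hom_ext fun _ y b m s => funext fun (r : R.psh.obj y.unop.1) => ?_),
      hom₂_ext hθ⟩
    -- The value of `f` is recovered from that of its uncurried form on identities.
    have key (f : S ⟶ imp R T) (m : ((prof f.dist).obj b).obj y) :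
        Hom.act ((uncurryFunctor R S T).obj f) (a := (y.unop.1.unop, b)) (b := op y.unop.2)
          (DIST.Coend.mk (M := DIST.tensor (A := R.base) (C := R.base) Profunctor.id f.dist)
            (N := DIST.eval R.base T.base) (b := (y.unop.1.unop, y.unop))
            (𝟙 y.unop.1.unop, 𝟙 y.unop.2) (𝟙 y.unop.1.unop, m)) (r, s) =
        Hom.act (S := imp R T) f m s r := by
      refine (uncurryFunctor_act f (x := (y.unop.1.unop, b)) (c := op y.unop.2)
        (𝟙 y.unop.1.unop, 𝟙 y.unop.2) (𝟙 y.unop.1.unop) m r s).trans ?_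
      refine (Functor.map_id_apply T.psh _ _).trans (congrArg (Hom.act (S := imp R T) f m s) ?_)
      exact (Functor.map_id_apply R.psh _ _).trans (Functor.map_id_apply R.psh _ _)
    refine (key g _).symm.trans (Eq.trans ?_ (key f m))
    have hw := ConcreteCategory.congr_hom (NatTrans.congr_app (NatTrans.congr_app η.w ⟨⟨⟩⟩)
      (op y.unop.2)) (DIST.Coend.mk (M := (tensorObj R S).rel)
        (N := ((uncurryFunctor R S T).obj f).dist) (b := (y.unop.1.unop, b))
        (DIST.Coend.mk (M := DIST.tensor (A := R.base) (C := R.base) Profunctor.id f.dist)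
            (N := DIST.eval R.base T.base) (b := (y.unop.1.unop, y.unop))
            (𝟙 y.unop.1.unop, 𝟙 y.unop.2) (𝟙 y.unop.1.unop, m)) (r, s))
    rw [← hθ] at hw
    exact hw

/-- The function attached to an element of `M` by the action of `h` is natural in `(Aᵒᵖ × C)ᵒᵖ`. -/
theorem act_map_impHom {R S T : PSH.{u}} (h : tensorObj R S ⟶ T)
    {M : S.base ⟶ DIST.imp R.base T.base}
    (e : (DIST.homCurrying R.base S.base T.base).functor.obj M ⟶ h.dist) {a a' : R.base}
    {b : S.base} {c c' : T.base} (k : a ⟶ a') (g : c' ⟶ c)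
    (m : ((prof M).obj b).obj (op (op a, c))) (r : R.psh.obj (op a')) (s : S.psh.obj (op b)) :
    Hom.act h (a := (a', b)) (b := op c') (NatTrans.app (NatTrans.app e (a', b)) (op c')
        (((prof M).obj b).map (DIST.impHom k g) m)) (r, s) =
      T.psh.map g.op (Hom.act h (a := (a, b)) (b := op c)
        (NatTrans.app (NatTrans.app e (a, b)) (op c) m) (R.psh.map k.op r, s)) := by
  let N : DIST.prod R.base S.base ⟶ T.base :=
    (DIST.homCurrying R.base S.base T.base).functor.obj M
  let K : ((a, b) : R.base × S.base) ⟶ (a', b) := Prod.mkHom k (𝟙 b)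
  have h₁ : ((prof M).obj b).map (DIST.impHom k g) m =
      ((prof N).obj (a', b)).map g.op (((prof N).map K).app (op c) m) := by
    refine Eq.symm (Eq.trans (congrArg (((prof M).obj b).map (DIST.impHom (𝟙 a') g))
      (DIST.map_id_app M b _ (((prof M).obj b).map (DIST.impHom k (𝟙 c)) m))) ?_)
    refine (DIST.map_impHom ((prof M).obj b) k (𝟙 c) (𝟙 a') g m).trans ?_
    rw [Category.comp_id, Category.comp_id]
  have h₂ : (tensorObj R S).psh.map K.op (r, s) = (R.psh.map k.op r, s) :=
    Prod.ext rfl (show S.psh.map (𝟙 (op b)) s = s from Functor.map_id_apply S.psh _ s)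
  refine (congrArg (fun z => Hom.act h (a := (a', b)) (b := op c')
    (NatTrans.app (NatTrans.app e (a', b)) (op c') z) (r, s)) h₁).trans ?_
  refine (congrArg (fun z => Hom.act h (a := (a', b)) (b := op c') z (r, s))
    (DIST.naturality_right e (a', b) g.op _)).trans ?_
  refine (Hom.map_act h (a := (a', b)) g.op _ (r, s)).trans (congrArg (T.psh.map g.op) ?_)
  refine (congrArg (fun z => Hom.act h (a := (a', b)) (b := op c) z (r, s))
    (DIST.naturality_left e K (op c) m)).trans ?_
  exact (Hom.act_map h K _ (r, s)).symm.trans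
    (congrArg (Hom.act h (a := (a, b)) (b := op c) _) h₂)

/-- The function attached to an element of `M` by the action of `h` is compatible with the coend
relation over `B`. -/
theorem act_map_right {R S T : PSH.{u}} (h : tensorObj R S ⟶ T)
    {M : S.base ⟶ DIST.imp R.base T.base}
    (e : (DIST.homCurrying R.base S.base T.base).functor.obj M ⟶ h.dist) {a : R.base}
    {b b' : S.base} {c : T.base} (k : b ⟶ b')
    (m : ((prof M).obj b).obj (op (op a, c))) (r : R.psh.obj (op a)) (s : S.psh.obj (op b')) :
    Hom.act h (a := (a, b)) (b := op c) (NatTrans.app (NatTrans.app e (a, b)) (op c) m)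
        (r, S.psh.map k.op s) =
      Hom.act h (a := (a, b')) (b := op c) (NatTrans.app (NatTrans.app e (a, b')) (op c)
        (((prof M).map k).app _ m)) (r, s) := by
  let K : ((a, b) : R.base × S.base) ⟶ (a, b') := Prod.mkHom (𝟙 a) k
  have h₁ : (tensorObj R S).psh.map K.op (r, s) = (r, S.psh.map k.op s) :=
    Prod.ext (show R.psh.map (𝟙 (op a)) r = r from Functor.map_id_apply R.psh _ r) rfl
  refine (congrArg (Hom.act h (a := (a, b)) (b := op c) _) h₁.symm).trans ?_
  refine (Hom.act_map h K _ (r, s)).trans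
    (congrArg (fun z => Hom.act h (a := (a, b')) (b := op c) z (r, s)) ?_)
  refine (DIST.naturality_left e K (op c) m).symm.trans
    (congrArg (NatTrans.app (NatTrans.app e (a, b')) (op c)) ?_)
  exact congrArg (((prof M).map k).app _) (DIST.map_impHom_id ((prof M).obj b) m)

/-- The curried form of a 1-cell `h : R ⊗ S ⟶ T`, over a distributor `M` whose uncurried form maps
to that of `h`. -/
def curryObj {R S T : PSH.{u}} (h : tensorObj R S ⟶ T) {M : S.base ⟶ DIST.imp R.base T.base}
    (e : (DIST.homCurrying R.base S.base T.base).functor.obj M ⟶ h.dist) : S ⟶ imp R T where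
  dist := M
  cell := cellMk (S := imp R T) (M := M) (fun b y m s => fun (r : R.psh.obj y.unop.1) =>
      Hom.act h (a := (y.unop.1.unop, b)) (b := op y.unop.2)
        (NatTrans.app (NatTrans.app e (y.unop.1.unop, b)) (op y.unop.2) m) (r, s))
    (fun _ _ k _ m s => funext fun r => act_map_right h e k m r s)
    (fun _ _ _ g m s => funext fun r => act_map_impHom h e g.unop.1.unop g.unop.2 m r s)

instance (R S T : PSH.{u}) : (uncurryFunctor R S T).EssSurj where
  mem_essImage h := by
    let e := (DIST.homCurrying R.base S.base T.base).counitIso.app h.dist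
    refine ⟨curryObj h e.hom, ⟨isoMk ((DIST.uncurryFunctorIso R.base S.base T.base).app _ ≪≫ e)
      (DIST.hom_ext fun _ c x y rs => ?_)⟩⟩
    induction y using DIST.Coend.ind with | _ b n m
    refine (act_map_impHom h e.hom (n.1 ≫ m.1) n.2 m.2 rs.1 rs.2).trans ?_
    exact congrArg (fun z => T.psh.map n.2.op (Hom.act h (a := (b.2.1.unop, x.2)) (b := op b.2.2)
      (NatTrans.app (NatTrans.app e.hom (b.2.1.unop, x.2)) (op b.2.2) m.2) (z, rs.2)))
      (map_op_comp R.psh n.1 m.1 rs.1)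

theorem uncurryFunctor_isEquivalence (R S T : PSH.{u}) : (uncurryFunctor R S T).IsEquivalence where

end PSH
end

/-! ### Closed structures and duals from evaluations -/

section
variable {C : Type*} [Category C] [MonoidalCategory C]

/-- Composition with an evaluation, `g ↦ ev ∘ (id ⊗ g)`, as a bijection with inverse currying. -/
noncomputable def curryEquiv {X Y H : C} (ev : X ⊗ H ⟶ Y)
    (bij : ∀ Z : C, Function.Bijective fun g : Z ⟶ H => X ◁ g ≫ ev) (Z : C) :
    ((tensorLeft X).obj Z ⟶ Y) ≃ (Z ⟶ H) :=
  (Equiv.ofBijective (fun g : Z ⟶ H => X ◁ g ≫ ev) (bij Z)).symm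

theorem curryEquiv_naturality {X Y H : C} (ev : X ⊗ H ⟶ Y)
    (bij : ∀ Z : C, Function.Bijective fun g : Z ⟶ H => X ◁ g ≫ ev) {Z Z' : C} (f : Z' ⟶ Z)
    (g : (tensorLeft X).obj Z ⟶ Y) :
    curryEquiv ev bij Z' ((tensorLeft X).map f ≫ g) = f ≫ curryEquiv ev bij Z g := by
  obtain ⟨k, rfl⟩ := (curryEquiv ev bij Z).symm.surjective g
  rw [Equiv.apply_symm_apply, ← Equiv.eq_symm_apply]
  simp [curryEquiv]

/-- A monoidal category is closed if every `X ⊗ -` has universal evaluations. -/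
@[reducible] noncomputable def MonoidalClosed.ofEval (H : C → C → C)
    (ev : ∀ X Y, X ⊗ H X Y ⟶ Y)
    (bij : ∀ X Y Z : C, Function.Bijective fun g : Z ⟶ H X Y => X ◁ g ≫ ev X Y) :
    MonoidalClosed C where
  closed X :=
    { rightAdj := Adjunction.rightAdjointOfEquiv (F := tensorLeft X)
        (fun Z Y => curryEquiv (ev X Y) (bij X Y) Z)
        (fun _ _ Y f g => curryEquiv_naturality (ev X Y) (bij X Y) f g)
      adj := Adjunction.adjunctionOfEquivRight _ _ }

theorem MonoidalClosed.ofEval_ev (H : C → C → C) (ev : ∀ X Y, X ⊗ H X Y ⟶ Y)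
    (bij : ∀ X Y Z : C, Function.Bijective fun g : Z ⟶ H X Y => X ◁ g ≫ ev X Y) (X Y : C) :
    letI := MonoidalClosed.ofEval H ev bij
    (ihom.ev X).app Y = X ◁ 𝟙 (H X Y) ≫ ev X Y := rfl

/-- If the morphism `ε : A ⊗ A' ⟶ 1` makes `A' ⊗ B` an internal hom from `A` to `B`, for all `B`,
then `A'` and `A` form an exact pairing; the coevaluation is the transpose of the right unitor. -/
@[reducible] noncomputable def exactPairingOfBijective {A A' : C} (ε : A ⊗ A' ⟶ 𝟙_ C)
    (bij : ∀ Y B : C, Function.Bijective fun g : Y ⟶ A' ⊗ B =>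
      A ◁ g ≫ (α_ A A' B).inv ≫ ε ▷ B ≫ (λ_ B).hom) : ExactPairing A' A :=
  let η : 𝟙_ C ⟶ A' ⊗ A := ((bij (𝟙_ C) A).2 (ρ_ A).hom).choose
  have hη : A ◁ η ≫ (α_ A A' A).inv ≫ ε ▷ A = (ρ_ A).hom ≫ (λ_ A).inv := by
    have h : A ◁ η ≫ (α_ A A' A).inv ≫ ε ▷ A ≫ (λ_ A).hom = (ρ_ A).hom :=
      ((bij (𝟙_ C) A).2 (ρ_ A).hom).choose_spec
    simp [← h]
  { coevaluation' := η
    evaluation' := ε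
    coevaluation_evaluation' := hη
    evaluation_coevaluation' := by
      -- Both sides have the same transpose.
      apply (bij (𝟙_ C ⊗ A') (𝟙_ C)).1
      calc
        A ◁ (η ▷ A' ≫ (α_ A' A A').hom ≫ A' ◁ ε) ≫ (α_ A A' (𝟙_ C)).inv ≫ ε ▷ 𝟙_ C ≫
            (λ_ (𝟙_ C)).hom =
          (α_ A (𝟙_ C) A').inv ≫ (A ◁ η ≫ (α_ A A' A).inv ≫ ε ▷ A) ▷ A' ≫
            (α_ (𝟙_ C) A A').hom ≫ 𝟙_ C ◁ ε ≫ (λ_ (𝟙_ C)).hom := by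
          simp only [MonoidalCategory.whiskerLeft_comp, comp_whiskerRight, Category.assoc]
          -- Slide the right-hand `ε` past the left-hand one.
          rw [associator_inv_naturality_right_assoc, whisker_exchange_assoc,
            associator_naturality_left_assoc, ← associator_inv_naturality_middle_assoc]
          rw [pentagon_inv_inv_hom_hom_inv_assoc]
        _ = A ◁ (λ_ A').hom ≫ ε := by
          rw [hη]
          simp
        _ = A ◁ ((λ_ A').hom ≫ (ρ_ A').inv) ≫ (α_ A A' (𝟙_ C)).inv ≫ ε ▷ 𝟙_ C ≫
            (λ_ (𝟙_ C)).hom := by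
          simp [unitors_equal] }

end

/-- An equivalence of hom-categories induces a bijection of isomorphism classes of 1-cells. -/
theorem Ho.bijective_of_isEquivalence {B : Type*} [Bicategory B] {X Y Z W : B}
    (F : (X ⟶ Y) ⥤ (Z ⟶ W)) [F.IsEquivalence]
    (φ : ((⟨X⟩ : Ho B) ⟶ ⟨Y⟩) → ((⟨Z⟩ : Ho B) ⟶ ⟨W⟩)) (h : ∀ f, φ (Ho.cls f) = Ho.cls (F.obj f)) :
    Function.Bijective φ := by
  constructor
  · rintro ⟨f⟩ ⟨g⟩ hfg
    obtain ⟨e⟩ : Nonempty (F.obj f ≅ F.obj g) :=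
      Quotient.exact (((h f).symm.trans hfg).trans (h g))
    exact Quotient.sound ⟨F.preimageIso e⟩
  · rintro ⟨g⟩
    exact ⟨Ho.cls (F.objPreimage g), (h _).trans (Quotient.sound ⟨F.objObjPreimageIso g⟩)⟩

section
open Opposite

namespace PSH

/-- The closed structure of the category of presheaves. -/
@[reducible] noncomputable def monoidalClosed :
    letI := isMonoidal.{u}.monoidalCategory
    MonoidalClosed (Ho PSH.{u}) :=
  letI := isMonoidal.{u}.monoidalCategory
  MonoidalClosed.ofEval (fun R S => ⟨imp R.as S.as⟩) (fun R S => Ho.cls (eval R.as S.as))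
    (fun R T S =>
      have := uncurryFunctor_isEquivalence R.as S.as T.as
      Ho.bijective_of_isEquivalence (uncurryFunctor R.as S.as T.as) _ fun _ => rfl)

end PSH

namespace DIST

/-- The closed structure of the category of distributors. -/
@[reducible] noncomputable def monoidalClosed :
    letI := isMonoidal.{u}.monoidalCategory
    MonoidalClosed (Ho DIST.{u}) :=
  letI := isMonoidal.{u}.monoidalCategory
  MonoidalClosed.ofEval (fun A B => ⟨imp A.as B.as⟩) (fun A B => Ho.cls (eval A.as B.as))
    (fun A C B =>
      have := uncurryFunctor_isEquivalence A.as B.as C.as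
      Ho.bijective_of_isEquivalence (uncurryFunctor A.as B.as C.as) _ fun _ => rfl)

/-! ### Duality of distributors -/

/-- The square lemma `PSH.Map.square` without presheaves. -/
theorem square {A B C D : DIST.{u}} {F : A ⥤ B} {G : C ⥤ D} (hG : G.IsEquivalence)
    {M : A ⟶ C} {N : B ⟶ D} (θ : PSH.prof M ⟶ (PSH.prof N).whiskerLeft₂ F G)
    (h : ∀ (a : A) (c : C), Function.Bijective ((θ.app a).app (op c))) :
    Ho.cls M ≫ Ho.cls (emb G) = Ho.cls (emb F) ≫ Ho.cls N :=
  Quotient.sound ⟨isoOfBijective (squareHom θ) (squareHom_bijective θ h) ≪≫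
    (isoOfBijective (embCompHom F N) (embCompHom_bijective F N)).symm⟩

/-- The counit `A ⊗ Aᵒᵖ ⇸ 1` of the duality, `(*, (a, a')) ↦ hom(a', a)`. -/
def dualEval (A : DIST.{u}) : prod A (opp A) ⟶ unit :=
  show Profunctor.{u} (A × (A : Type u)ᵒᵖ) (Discrete PUnit.{u + 1}) from
  { obj x := (Functor.const _).obj (x.2.unop ⟶ x.1)
    map f := { app _ := ↾fun k => f.2.unop ≫ k ≫ f.1 } }

/-- Evaluation is the counit of the duality applied to the first two factors. -/
theorem dualEval_tensor (A B : DIST.{u}) :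
    Ho.cls (tensor (A := prod A (opp A)) (C := unit) (dualEval A) (𝟙 B : B ⟶ B)) ≫
        Ho.cls (emb (A := prod unit B) (CategoryTheory.prod.leftUnitor B)) =
      Ho.cls (emb (A := prod (prod A (opp A)) B) (B := prod A (prod (opp A) B))
        (CategoryTheory.prod.associator A (opp A) B)) ≫ Ho.cls (eval A B) :=
  square (CategoryTheory.prod.leftUnitor_isEquivalence (B : Type u))
    (NatTrans.mk (fun _ => NatTrans.mk (fun _ => ↾fun m => m) (fun _ _ _ => rfl))
      (fun _ _ _ => rfl))
    (fun _ _ => Function.bijective_id)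

theorem nonempty_exactPairing (A : Ho DIST.{u}) :
    letI := isMonoidal.{u}.monoidalCategory
    Nonempty (ExactPairing A ⟨opp A.as⟩) := by
  let := isMonoidal.{u}.monoidalCategory
  let := symmetricCategory.{u}
  have : ExactPairing (⟨opp A.as⟩ : Ho DIST.{u}) A :=
    exactPairingOfBijective (A := A) (A' := ⟨opp A.as⟩) (Ho.cls (dualEval A.as)) (fun B C => by
      have h : (α_ A ⟨opp A.as⟩ C).inv ≫ (Ho.cls (dualEval A.as) ▷ C : (⟨_⟩ : Ho DIST.{u}) ⟶ _) ≫
          (λ_ C).hom = Ho.cls (eval A.as C.as) :=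
        (Iso.inv_comp_eq _).2 (dualEval_tensor A.as C.as)
      have := uncurryFunctor_isEquivalence A.as B.as C.as
      refine Ho.bijective_of_isEquivalence (uncurryFunctor A.as B.as C.as) _ fun f => ?_
      exact congrArg (A ◁ Ho.cls f ≫ ·) h)
  exact ⟨BraidedCategory.exactPairing_swap _ _⟩

end DIST

namespace PSH

/-- The comparison is the transpose of evaluation itself, so it is the identity. -/
theorem preservesImplication :
    letI := DIST.isMonoidal.{u}.monoidalCategory
    letI := PSH.isMonoidal.{u}.monoidalCategory
    letI := DIST.symmetricCategory.{u}
    letI := PSH.symmetricCategory.{u}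
    letI := DIST.monoidalClosed.{u}
    letI := PSH.monoidalClosed.{u}
    letI := braidedP.{u}
    PreservesImplication PSH.p.{u} := by
  let := DIST.isMonoidal.{u}.monoidalCategory
  let := PSH.isMonoidal.{u}.monoidalCategory
  let := DIST.symmetricCategory.{u}
  let := PSH.symmetricCategory.{u}
  let := DIST.monoidalClosed.{u}
  let := PSH.monoidalClosed.{u}
  let := braidedP.{u}
  intro R S
  have h : MonoidalClosed.curry
      (Functor.LaxMonoidal.μ p.{u} R ((ihom R).obj S) ≫ p.map ((ihom.ev R).app S)) =
      (𝟙 ((ihom (p.obj R)).obj (p.obj S)) : p.obj ((ihom R).obj S) ⟶ _) := by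
    refine (MonoidalClosed.curry_eq_iff _ _).2 ?_
    exact (Category.id_comp _).trans
      (MonoidalClosed.uncurry_id_eq_ev (p.obj R) (p.obj S)).symm
  rw [h]
  exact IsIso.id ((ihom (p.obj R)).obj (p.obj S))

end PSH
end

theorem mainTheorem4 :
    ∃ (hD : IsMonoidal DIST.monoidalStruct.{u}) (hP : IsMonoidal PSH.monoidalStruct.{u}),
      letI := hD.monoidalCategory
      letI := hP.monoidalCategory
      ∃ (_ : SymmetricCategory (Ho DIST.{u})) (_ : SymmetricCategory (Ho PSH.{u}))
        (_ : MonoidalClosed (Ho DIST.{u})) (_ : MonoidalClosed (Ho PSH.{u}))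
        (_ : PSH.p.{u}.Braided),
        (∀ A B : Ho DIST.{u}, β_ A B = DIST.braid A B) ∧
        (∀ R S : Ho PSH.{u}, β_ R S = PSH.braid R S) ∧
        (∀ A B : Ho DIST.{u}, ∃ h : (ihom A).obj B = ⟨DIST.imp A.as B.as⟩,
          (ihom.ev A).app B = A ◁ eqToHom h ≫ Ho.cls (DIST.eval A.as B.as)) ∧
        (∀ R S : Ho PSH.{u}, ∃ h : (ihom R).obj S = ⟨PSH.imp R.as S.as⟩,
          (ihom.ev R).app S = R ◁ eqToHom h ≫ Ho.cls (PSH.eval R.as S.as)) ∧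
        (∃ h, Functor.LaxMonoidal.ε PSH.p.{u} = eqToHom h) ∧
        (∀ R S : Ho PSH.{u}, ∃ h, Functor.LaxMonoidal.μ PSH.p.{u} R S = eqToHom h) ∧
        PreservesImplication PSH.p.{u} ∧
        (∀ A : Ho DIST.{u}, Nonempty (ExactPairing A ⟨DIST.opp A.as⟩)) ∧
        (∀ A B C : DIST.{u}, (DIST.uncurryFunctor A B C).IsEquivalence) ∧
        (∀ R S T : PSH.{u}, (PSH.uncurryFunctor R S T).IsEquivalence) :=
  letI := DIST.isMonoidal.{u}.monoidalCategory
  letI := PSH.isMonoidal.{u}.monoidalCategory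
  ⟨DIST.isMonoidal, PSH.isMonoidal, DIST.symmetricCategory, PSH.symmetricCategory,
    DIST.monoidalClosed, PSH.monoidalClosed, PSH.braidedP,
    fun _ _ => rfl, fun _ _ => rfl,
    fun _ _ => ⟨rfl, MonoidalClosed.ofEval_ev _ _ _ _ _⟩,
    fun _ _ => ⟨rfl, MonoidalClosed.ofEval_ev _ _ _ _ _⟩,
    ⟨rfl, rfl⟩, fun _ _ => ⟨rfl, rfl⟩, PSH.preservesImplication, DIST.nonempty_exactPairing,
    DIST.uncurryFunctor_isEquivalence, PSH.uncurryFunctor_isEquivalence⟩
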